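/- Let $M$ be a smooth oriented Riemannian manifold of dimension $m=n+l$ with Levi-Civita connection $\nabla$ and volume form $\Omega$, let $D$ be a smooth distribution of rank $n$ on $M$, and let $F=D^{\perp}$ (of rank $l$). Write $v^{\bot}$ for the $F$-component of a tangent vector $v$, and let $B(X,Y)=(\nabla_YX)^{\bot}$, for $X,Y$ tangent to $D$, be the (in general non-symmetric) second fundamental form of $D$. An adapted frame on an open set $U\subseteq M$ is a smooth orthonormal frame $e_1,\dots,e_m$ on $U$ with $e_1,\dots,e_n$ tangent to $D$ and $e_{n+1},\dots,e_m$ tangent to $F$. Let $\theta^1,\dots,\theta^m$ be its dual coframe and $\omega^{AB}(v)=-\langle\nabla_v e_A,e_B\rangle$ its connection forms, and put $B_i^j=B(e_j,e_i)$ for $1\le i,j\le n$. Let $r=2s$ with $0\le r\le n$. In an adapted frame put $$S_r=\frac1{r!}\sum_{i_1,\dots,i_r,\,j_1,\dots,j_r=1}^{n}\delta^{i_1\dots i_r}_{j_1\dots j_r}\langle B_{i_1}^{j_1},B_{i_2}^{j_2}\rangle\cdots\langle B_{i_{r-1}}^{j_{r-1}},B_{i_r}^{j_r}\rangle ,\qquad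 \nu=\theta^{n+1}\wedge\dots\wedge\theta^{m},$$ $$\Gamma_r=\sum_{\sigma\in\Sigma_n}\ \sum_{\beta_1,\dots,\beta_s=n+1}^{m}\varepsilon(\sigma)\,(\omega^{\sigma(1)\beta_1}\wedge\omega^{\sigma(2)\beta_1})\wedge\dots\wedge(\omega^{\sigma(2s-1)\beta_s}\wedge\omega^{\sigma(2s)\beta_s})\wedge\theta^{\sigma(2s+1)}\wedge\dots\wedge\theta^{\sigma(n)},$$ where $\Sigma_n$ is the group of permutations of $\{1,\dots,n\}$, $\varepsilon$ is the sign, and the generalized Kronecker symbol $\delta^{i_1\dots i_r}_{j_1\dots j_r}$ is $+1$ or $-1$ if the $i$'s are distinct and the $j$'s are an even or odd permutation of them, and $0$ otherwise (so $S_0=1$). Then $S_r$ does not depend on the adapted frame, hence is a function on all of $M$, and for every adapted frame that is positively oriented with respect to $M$, $$\frac{1}{r!\,(n-r)!}\,\Gamma_r\wedge\nu=S_r\,\Omega .$$ In particular $\Gamma_r\wedge\nu$ is a well-defined $m$-form on $M$, and if $M$ is compact, then the Brito–Naveira total curvature $S_r^T=\frac{1}{r!(n-r)!}\int_M\Gamma_r\wedge\nu$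 equals $\int_M S_r$, the integral of $S_r$ with respect to the Riemannian volume measure. -/

import Mathlib

open Bundle Manifold MeasureTheory Module
open scoped ContDiff Topology

noncomputable section

namespace DistributionCurvature

/-! ### Multilinear algebra -/

section Algebra

variable {V : Type*} [AddCommGroup V] [Module ℝ V]

/-- The wedge product `η₁ ∧ ⋯ ∧ ηₖ` of covectors:
`(η₁ ∧ ⋯ ∧ ηₖ)(v₁, …, vₖ) = det (ηₐ(v_b))`. -/
def wedgeCovectors {k : ℕ} (η : Fin k → Dual ℝ V) : V [⋀^Fin k]→ₗ[ℝ] ℝ :=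
  (Matrix.detRowAlternating (R := ℝ) (n := Fin k)).compLinearMap (LinearMap.pi η)

/-- The wedge product of a `p`-form and a `q`-form (the sum over `(p, q)`-shuffles). -/
def wedge {p q : ℕ} (a : V [⋀^Fin p]→ₗ[ℝ] ℝ) (b : V [⋀^Fin q]→ₗ[ℝ] ℝ) :
    V [⋀^Fin (p + q)]→ₗ[ℝ] ℝ :=
  ((LinearMap.mul' ℝ ℝ).compAlternatingMap (a.domCoprod b)).domDomCongr finSumFinEquiv

/-- The generalized Kronecker symbol `δ^{i₁…i_r}_{j₁…j_r}`: it is `sign τ` if the `i`'s are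
distinct and `j = i ∘ τ` for a (then unique) permutation `τ`, and `0` otherwise. -/
def kroneckerSymbol {ι : Type*} [DecidableEq ι] {r : ℕ} (i j : Fin r → ι) : ℝ :=
  open Classical in
  if Function.Injective i then
    ∑ τ : Equiv.Perm (Fin r), if j = i ∘ τ then ((Equiv.Perm.sign τ : ℤ) : ℝ) else 0
  else 0

/-- The family `v` is a basis which is positively oriented with respect to `o`. -/
def IsPositiveBasis {m : ℕ} (o : Orientation ℝ V (Fin m)) (v : Fin m → V) : Prop :=
  ∃ b : Basis (Fin m) ℝ V, ⇑b = v ∧ b.orientation = o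

/-- `1` if `v` is a positively oriented basis, `-1` otherwise. -/
def orientationSign {m : ℕ} (o : Orientation ℝ V (Fin m)) (v : Fin m → V) : ℝ :=
  open Classical in if IsPositiveBasis o v then 1 else -1

end Algebra

/-! ### Distributions, orientations, frames -/

section Geometry

variable {n l : ℕ} {M : Type*} [TopologicalSpace M]
  [ChartedSpace (EuclideanSpace ℝ (Fin (n + l))) M]

instance instFiniteDimensionalTangentSpace (x : M) :
    FiniteDimensional ℝ (TangentSpace (𝓡 (n + l)) x) :=
  inferInstanceAs (FiniteDimensional ℝ (EuclideanSpace ℝ (Fin (n + l))))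

instance instFactFinrankTangentSpace (x : M) :
    Fact (finrank ℝ (TangentSpace (𝓡 (n + l)) x) = n + l) :=
  ⟨(finrank_euclideanSpace_fin : finrank ℝ (EuclideanSpace ℝ (Fin (n + l))) = n + l)⟩

/-- The vector field `X` is smooth on the set `U`. -/
def IsSmoothFieldOn [IsManifold (𝓡 (n + l)) ∞ M]
    (X : ∀ x : M, TangentSpace (𝓡 (n + l)) x) (U : Set M) : Prop :=
  ContMDiffOn (𝓡 (n + l)) (𝓡 (n + l)).tangent ∞
    (fun x => (⟨x, X x⟩ : TangentBundle (𝓡 (n + l)) M)) U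

/-- `D` is a smooth distribution of rank `n`: near every point it is spanned by `n` smooth
pointwise linearly independent vector fields. -/
def IsSmoothDistribution [IsManifold (𝓡 (n + l)) ∞ M]
    (D : ∀ x : M, Submodule ℝ (TangentSpace (𝓡 (n + l)) x)) : Prop :=
  ∀ x : M, ∃ U ∈ 𝓝 x, ∃ X : Fin n → ∀ y : M, TangentSpace (𝓡 (n + l)) y,
    (∀ i, IsSmoothFieldOn (X i) U) ∧
    ∀ y ∈ U, LinearIndependent ℝ (fun i => X i y) ∧
      Submodule.span ℝ (Set.range fun i => X i y) = D y

/-- The pointwise orientations `o x` of the tangent spaces form an orientation of the manifold: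
near every point there is a smooth frame which is positively oriented at each point. -/
def IsManifoldOrientation [IsManifold (𝓡 (n + l)) ∞ M]
    (o : ∀ x : M, Orientation ℝ (TangentSpace (𝓡 (n + l)) x) (Fin (n + l))) : Prop :=
  ∀ x : M, ∃ U ∈ 𝓝 x, ∃ X : Fin (n + l) → ∀ y : M, TangentSpace (𝓡 (n + l)) y,
    (∀ A, IsSmoothFieldOn (X A) U) ∧ ∀ y ∈ U, IsPositiveBasis (o y) (fun A => X A y)

variable [IsManifold (𝓡 (n + l)) ∞ M]
  [RiemannianBundle (fun x : M => TangentSpace (𝓡 (n + l)) x)]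

instance instRiemannianBundleOne
    [IsContMDiffRiemannianBundle (𝓡 (n + l)) ∞ (EuclideanSpace ℝ (Fin (n + l)))
      (fun x : M => TangentSpace (𝓡 (n + l)) x)] :
    IsContMDiffRiemannianBundle (𝓡 (n + l)) 1 (EuclideanSpace ℝ (Fin (n + l)))
      (fun x : M => TangentSpace (𝓡 (n + l)) x) :=
  IsContMDiffRiemannianBundle.of_le (n := ∞) (by simp)

/-- `cov` is the Levi-Civita connection: smooth, torsion-free and metric. -/
structure IsLeviCivita
    [IsContMDiffRiemannianBundle (𝓡 (n + l)) ∞ (EuclideanSpace ℝ (Fin (n + l)))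
      (fun x : M => TangentSpace (𝓡 (n + l)) x)]
    (cov : CovariantDerivative (𝓡 (n + l)) (EuclideanSpace ℝ (Fin (n + l)))
      (fun x : M => TangentSpace (𝓡 (n + l)) x)) : Prop where
  smooth : CovariantDerivative.ContMDiffCovariantDerivative cov ∞
  torsion_eq_zero : cov.torsion = 0
  metric : cov.IsMetricCompatible

/-- A smooth orthonormal frame `e₁, …, e_{n+l}` on the open set `U`, adapted to `D` and
`F = Dᗮ`: the first `n` fields are tangent to `D`, the last `l` are tangent to `F`. -/
structure IsAdaptedFrame (D : ∀ x : M, Submodule ℝ (TangentSpace (𝓡 (n + l)) x)) (U : Set M)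
    (e : Fin (n + l) → ∀ x : M, TangentSpace (𝓡 (n + l)) x) : Prop where
  isOpen : IsOpen U
  smooth : ∀ A, IsSmoothFieldOn (e A) U
  orthonormal : ∀ x ∈ U, Orthonormal ℝ (fun A => e A x)
  tangent : ∀ x ∈ U, ∀ i : Fin n, e (Fin.castAdd l i) x ∈ D x
  normal : ∀ x ∈ U, ∀ α : Fin l, e (Fin.natAdd n α) x ∈ (D x)ᗮ

/-- The second fundamental form `B(X, Y) = (∇_Y X)^⊥` of `D`. -/
def secondFundamentalForm
    (cov : CovariantDerivative (𝓡 (n + l)) (EuclideanSpace ℝ (Fin (n + l)))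
      (fun x : M => TangentSpace (𝓡 (n + l)) x))
    (D : ∀ x : M, Submodule ℝ (TangentSpace (𝓡 (n + l)) x))
    (X Y : ∀ x : M, TangentSpace (𝓡 (n + l)) x) (x : M) : TangentSpace (𝓡 (n + l)) x :=
  (D x)ᗮ.starProjection (cov X x (Y x))

/-- The mean curvature `S_r`, `r = 2s`, computed in an adapted frame:
`(1/r!) δ^{i₁…i_r}_{j₁…j_r} ⟨B_{i₁}^{j₁}, B_{i₂}^{j₂}⟩ ⋯ ⟨B_{i_{r-1}}^{j_{r-1}}, B_{i_r}^{j_r}⟩`,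
where `B_i^j = B(e_j, e_i)`. -/
def frameMeanCurvature
    (cov : CovariantDerivative (𝓡 (n + l)) (EuclideanSpace ℝ (Fin (n + l)))
      (fun x : M => TangentSpace (𝓡 (n + l)) x))
    (D : ∀ x : M, Submodule ℝ (TangentSpace (𝓡 (n + l)) x)) (s : ℕ)
    (e : Fin (n + l) → ∀ x : M, TangentSpace (𝓡 (n + l)) x) (x : M) : ℝ :=
  let B (i j : Fin n) : TangentSpace (𝓡 (n + l)) x :=
    secondFundamentalForm cov D (e (Fin.castAdd l j)) (e (Fin.castAdd l i)) x
  (1 / ((2 * s).factorial : ℝ)) *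
    ∑ i : Fin (2 * s) → Fin n, ∑ j : Fin (2 * s) → Fin n, kroneckerSymbol i j *
      ∏ k : Fin s,
        inner ℝ (B (i ⟨2 * k, by omega⟩) (j ⟨2 * k, by omega⟩))
          (B (i ⟨2 * k + 1, by omega⟩) (j ⟨2 * k + 1, by omega⟩))

/-- The mean curvature function `S_r`, `r = 2s`, of `D`: its value at `x` is computed in any
adapted frame on a neighbourhood of `x`. -/
def meanCurvature
    (cov : CovariantDerivative (𝓡 (n + l)) (EuclideanSpace ℝ (Fin (n + l)))
      (fun x : M => TangentSpace (𝓡 (n + l)) x))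
    (D : ∀ x : M, Submodule ℝ (TangentSpace (𝓡 (n + l)) x)) (s : ℕ) (x : M) : ℝ :=
  open Classical in
  if h : ∃ e : Fin (n + l) → ∀ x : M, TangentSpace (𝓡 (n + l)) x,
      ∃ U : Set M, x ∈ U ∧ IsAdaptedFrame D U e
  then frameMeanCurvature cov D s h.choose x else 0

/-- The connection form `ω^{AB}`: `ω^{AB}(v) = -⟨∇_v e_A, e_B⟩`. -/
def connectionForm
    (cov : CovariantDerivative (𝓡 (n + l)) (EuclideanSpace ℝ (Fin (n + l)))
      (fun x : M => TangentSpace (𝓡 (n + l)) x))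
    (e : Fin (n + l) → ∀ x : M, TangentSpace (𝓡 (n + l)) x) (A B : Fin (n + l)) (x : M) :
    Dual ℝ (TangentSpace (𝓡 (n + l)) x) :=
  -((innerₗ (TangentSpace (𝓡 (n + l)) x) (e B x)) ∘ₗ (cov (e A) x).toLinearMap)

/-- The coframe dual to an orthonormal frame: `θ^A(v) = ⟨e_A, v⟩`. -/
def coframe (e : Fin (n + l) → ∀ x : M, TangentSpace (𝓡 (n + l)) x) (A : Fin (n + l)) (x : M) :
    Dual ℝ (TangentSpace (𝓡 (n + l)) x) :=
  innerₗ (TangentSpace (𝓡 (n + l)) x) (e A x)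

/-- The Brito-Naveira `n`-form `Γ_r`, `r = 2s`: the sum over the permutations `σ` and the indices
`β₁, …, β_s` of
`ε(σ) (ω^{σ(1)β₁} ∧ ω^{σ(2)β₁}) ∧ ⋯ ∧ (ω^{σ(2s-1)β_s} ∧ ω^{σ(2s)β_s}) ∧ θ^{σ(2s+1)} ∧ ⋯ ∧ θ^{σ(n)}`.
-/
def gammaForm
    (cov : CovariantDerivative (𝓡 (n + l)) (EuclideanSpace ℝ (Fin (n + l)))
      (fun x : M => TangentSpace (𝓡 (n + l)) x)) (s : ℕ)
    (e : Fin (n + l) → ∀ x : M, TangentSpace (𝓡 (n + l)) x) (x : M) :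
    TangentSpace (𝓡 (n + l)) x [⋀^Fin n]→ₗ[ℝ] ℝ :=
  ∑ σ : Equiv.Perm (Fin n), ∑ β : Fin s → Fin l,
    ((Equiv.Perm.sign σ : ℤ) : ℝ) • wedgeCovectors (fun k : Fin n =>
      if h : (k : ℕ) < 2 * s then
        connectionForm cov e (Fin.castAdd l (σ k)) (Fin.natAdd n (β ⟨k / 2, by omega⟩)) x
      else coframe e (Fin.castAdd l (σ k)) x)

/-- The transverse volume form `ν = θ^{n+1} ∧ ⋯ ∧ θ^{n+l}`. -/
def transverseForm (e : Fin (n + l) → ∀ x : M, TangentSpace (𝓡 (n + l)) x) (x : M) :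
    TangentSpace (𝓡 (n + l)) x [⋀^Fin l]→ₗ[ℝ] ℝ :=
  wedgeCovectors (fun α : Fin l => coframe e (Fin.natAdd n α) x)

/-- The form `Γ_r ∧ ν`, `r = 2s`, on all of `M`: at `x` it is computed in any positively
oriented adapted frame on a neighbourhood of `x`. -/
def gammaWedgeNu
    (cov : CovariantDerivative (𝓡 (n + l)) (EuclideanSpace ℝ (Fin (n + l)))
      (fun x : M => TangentSpace (𝓡 (n + l)) x))
    (D : ∀ x : M, Submodule ℝ (TangentSpace (𝓡 (n + l)) x))
    (o : ∀ x : M, Orientation ℝ (TangentSpace (𝓡 (n + l)) x) (Fin (n + l))) (s : ℕ) (x : M) :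
    TangentSpace (𝓡 (n + l)) x [⋀^Fin (n + l)]→ₗ[ℝ] ℝ :=
  open Classical in
  if h : ∃ e : Fin (n + l) → ∀ x : M, TangentSpace (𝓡 (n + l)) x,
      ∃ U : Set M, x ∈ U ∧ IsAdaptedFrame D U e ∧ ∀ y ∈ U, IsPositiveBasis (o y) (fun A => e A y)
  then wedge (gammaForm cov s h.choose x) (transverseForm h.choose x) else 0

/-! ### Integration -/

/-- The coordinate fields `∂₁, …, ∂_m` of the chart `φ`, at the point with coordinates `y`. -/
def coordinateField (φ : OpenPartialHomeomorph M (EuclideanSpace ℝ (Fin (n + l))))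
    (y : EuclideanSpace ℝ (Fin (n + l))) (A : Fin (n + l)) :
    TangentSpace (𝓡 (n + l)) (φ.symm y) :=
  mfderiv (𝓡 (n + l)) (𝓡 (n + l)) φ.symm y (EuclideanSpace.single A (1 : ℝ))

/-- The Riemannian volume of the domain of the chart `φ`, as a measure on `M`: the measure
`√det(⟨∂_A, ∂_B⟩) dy` on the target of `φ`, transported to `M`. -/
def chartVolume [MeasurableSpace M]
    (φ : OpenPartialHomeomorph M (EuclideanSpace ℝ (Fin (n + l)))) : Measure M :=
  Measure.map φ.symm ((volume.restrict φ.target).withDensity fun y =>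
    ENNReal.ofReal (Real.sqrt (Matrix.det (Matrix.of fun A B : Fin (n + l) =>
      inner ℝ (coordinateField φ y A) (coordinateField φ y B)))))

variable (n l M) in
/-- The Riemannian volume measure: the least measure which dominates `chartVolume φ` for all
smooth charts `φ`. As these measures agree on overlaps, it restricts to `chartVolume φ` on the
domain of each `φ`. -/
def riemannianVolume [MeasurableSpace M] : Measure M :=
  ⨆ φ ∈ IsManifold.maximalAtlas (𝓡 (n + l)) ∞ M, chartVolume φ

variable (n l M) in
/-- Finitely many smooth charts with a subordinate smooth partition of unity. -/
structure ChartPartition where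
  N : ℕ
  chart : Fin N → OpenPartialHomeomorph M (EuclideanSpace ℝ (Fin (n + l)))
  chart_mem : ∀ i, chart i ∈ IsManifold.maximalAtlas (𝓡 (n + l)) ∞ M
  weight : SmoothPartitionOfUnity (Fin N) (𝓡 (n + l)) M Set.univ
  subordinate : weight.IsSubordinate fun i => (chart i).source

/-- The integral `∫_M Ψ` of an `m`-form over the oriented manifold `M`, by means of a partition of
unity: the sum over the charts of the integrals of `ρ Ψ(∂₁, …, ∂_m) dy`, with the opposite sign
where `∂₁, …, ∂_m` is negatively oriented. -/
def formIntegral (P : ChartPartition n l M)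
    (o : ∀ x : M, Orientation ℝ (TangentSpace (𝓡 (n + l)) x) (Fin (n + l)))
    (Ψ : ∀ x : M, TangentSpace (𝓡 (n + l)) x [⋀^Fin (n + l)]→ₗ[ℝ] ℝ) : ℝ :=
  ∑ i, ∫ y in (P.chart i).target,
    P.weight i ((P.chart i).symm y) *
      (orientationSign (o ((P.chart i).symm y)) (coordinateField (P.chart i) y) *
        Ψ ((P.chart i).symm y) (coordinateField (P.chart i) y))

/-- The Brito-Naveira total curvature `S_r^T = (1/(r!(n-r)!)) ∫_M Γ_r ∧ ν`, `r = 2s`. -/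
def totalCurvature (P : ChartPartition n l M)
    (cov : CovariantDerivative (𝓡 (n + l)) (EuclideanSpace ℝ (Fin (n + l)))
      (fun x : M => TangentSpace (𝓡 (n + l)) x))
    (D : ∀ x : M, Submodule ℝ (TangentSpace (𝓡 (n + l)) x))
    (o : ∀ x : M, Orientation ℝ (TangentSpace (𝓡 (n + l)) x) (Fin (n + l))) (s : ℕ) : ℝ :=
  1 / (((2 * s).factorial : ℝ) * ((n - 2 * s).factorial : ℝ)) *
    formIntegral P o (gammaWedgeNu cov D o s)

end Geometry

/-- A compact manifold has a finite smooth partition of unity subordinate to charts. -/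
theorem nonempty_chartPartition {n l : ℕ} {M : Type*} [TopologicalSpace M] [T2Space M]
    [CompactSpace M] [ChartedSpace (EuclideanSpace ℝ (Fin (n + l))) M]
    [IsManifold (𝓡 (n + l)) ∞ M] : Nonempty (ChartPartition n l M) := by
  obtain ⟨t, ht⟩ := CompactSpace.elim_nhds_subcover
    (fun x : M => (chartAt (EuclideanSpace ℝ (Fin (n + l))) x).source)
    (fun x => chart_source_mem_nhds _ x)
  let f := t.equivFin.symm
  obtain ⟨ρ, hρ⟩ := SmoothPartitionOfUnity.exists_isSubordinate (𝓡 (n + l))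
    (s := (Set.univ : Set M)) isClosed_univ
    (fun i : Fin t.card => (chartAt (EuclideanSpace ℝ (Fin (n + l))) (f i : M)).source)
    (fun i => (chartAt _ _).open_source) (by
      intro x _
      have : x ∈ ⋃ x ∈ t, (chartAt (EuclideanSpace ℝ (Fin (n + l))) x).source := by
        rw [ht]; trivial
      simp only [Set.mem_iUnion] at this ⊢
      obtain ⟨y, hy, hxy⟩ := this
      exact ⟨t.equivFin ⟨y, hy⟩, by simpa [f] using hxy⟩)
  exact ⟨⟨_, fun i => chartAt _ (f i : M),
    fun i => IsManifold.chart_mem_maximalAtlas _, ρ, hρ⟩⟩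

end DistributionCurvature

end

/-! Everything except the integral is multilinear algebra at one point. A top-degree form is
determined by its value on one basis, and `Ω` is `1` on a positive orthonormal frame, so `Γ_r ∧ ν`
need only be evaluated on the adapted frame. There `ν` absorbs exactly the normal vectors
(`wedge_wedgeCovectors_apply`), leaving `Γ_r(e_1, …, e_n)`.

Each summand of `Γ_r` is then a determinant whose first `r` rows hold components of `-∇e_{σ(k)}`
along a normal vector and whose other rows come from the permutation matrix of `σ`. In the Leibniz
expansion only those `τ` survive that agree with `σ` from place `r` on. Writing `σ = τκ`, the
permutation `κ` moves only the first `r` places and the summand depends only on the first `r` values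
of `τ`, each injective choice occurring `(n - r)!` times. This is `sum_sign_mul_det`. The signs
cancel since `r` is even, and summing over the `β`'s turns products of normal components into the
inner products `⟨B, B⟩`.

`S_r` is independent of the frame because `B(X, Y)` is tensorial in `X` too: differentiating
coefficients of tangent fields gives only terms in `D`, which the normal projection kills. Frames
then differ by an orthogonal matrix, and contraction with the Kronecker symbol is orthogonally
invariant.

For the integral, positive adapted frames exist near every point and `S_r` is continuous. Chart
volumes agree on overlaps by change of variables, and the orientation sign times `Ω(∂_1, …, ∂_m)` is
the density `√det g`, so the two integrals agree on each piece of the partition of unity. -/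

set_option linter.unusedSectionVars false

noncomputable section

namespace DistributionCurvature

/-! ### Permutation sums, the Kronecker symbol and wedge products -/

section Algebra

theorem kroneckerSymbol_eq_sum {ι : Type*} [DecidableEq ι] {r : ℕ} (i j : Fin r → ι) :
    kroneckerSymbol i j =
      ∑ τ : Equiv.Perm (Fin r), if j = i ∘ τ then ((Equiv.Perm.sign τ : ℤ) : ℝ) else 0 := by
  classical
  unfold kroneckerSymbol
  split_ifs with h
  · refine Finset.sum_congr rfl fun τ _ => ?_
    congr
  · symm
    simp only [Function.Injective, not_forall] at h
    obtain ⟨a, b, hab, hne⟩ := h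
    -- With a repeated index, composing with the transposition of its two places pairs off terms of
    -- opposite sign.
    have hi : ∀ τ : Equiv.Perm (Fin r), i ∘ (Equiv.swap a b * τ : Equiv.Perm (Fin r)) = i ∘ τ := by
      intro τ
      ext k
      simp only [Function.comp_apply, Equiv.Perm.coe_mul]
      rcases eq_or_ne (τ k) a with h1 | h1
      · rw [h1, Equiv.swap_apply_left, hab]
      rcases eq_or_ne (τ k) b with h2 | h2
      · rw [h2, Equiv.swap_apply_right, hab]
      · rw [Equiv.swap_apply_of_ne_of_ne h1 h2]
    refine Finset.sum_involution (fun τ _ => Equiv.swap a b * τ) ?_ ?_ ?_ ?_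
    · intro τ _
      rw [hi, Equiv.Perm.sign_mul, Equiv.Perm.sign_swap hne]
      split_ifs <;> simp
    · intro τ _ _ hτ
      exact hne (Equiv.swap_eq_one_iff.mp (mul_eq_right.mp hτ))
    · simp
    · intro τ _
      simp

/-- This form has no injectivity condition on `i`, so sums over `i` can later be factored place by
place. -/
theorem sum_kroneckerSymbol_mul {ι : Type*} [Fintype ι] [DecidableEq ι] {r : ℕ}
    (F : (Fin r → ι) → (Fin r → ι) → ℝ) :
    ∑ i, ∑ j, kroneckerSymbol i j * F i j =
      ∑ τ : Equiv.Perm (Fin r), ((Equiv.Perm.sign τ : ℤ) : ℝ) * ∑ i, F i (i ∘ τ) := by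
  simp_rw [kroneckerSymbol_eq_sum, Finset.sum_mul, Finset.mul_sum]
  rw [Finset.sum_comm (γ := Equiv.Perm (Fin r))]
  refine Finset.sum_congr rfl fun i _ => ?_
  rw [Finset.sum_comm]
  refine Finset.sum_congr rfl fun τ _ => ?_
  simp

/-- The contraction of the generalized Kronecker symbol with bilinear forms is invariant under
orthogonal changes of basis. -/
theorem sum_kroneckerSymbol_orthogonal {ι : Type*} [Fintype ι] [DecidableEq ι] {r : ℕ}
    (A : ι → ι → ℝ) (hA : ∀ p q, ∑ i, A i p * A i q = if p = q then 1 else 0)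
    (c c' : Fin r → ι → ι → ℝ)
    (hc : ∀ a i j, c' a i j = ∑ p, ∑ q, A i p * A j q * c a p q) :
    ∑ i, ∑ j, kroneckerSymbol i j * ∏ a, c' a (i a) (j a) =
      ∑ i, ∑ j, kroneckerSymbol i j * ∏ a, c a (i a) (j a) := by
  rw [sum_kroneckerSymbol_mul (fun i j => ∏ a, c' a (i a) (j a)),
    sum_kroneckerSymbol_mul (fun i j => ∏ a, c a (i a) (j a))]
  refine Finset.sum_congr rfl fun τ _ => ?_
  congr 1
  have h1 : ∀ i : Fin r → ι, ∏ a, c' a (i a) ((i ∘ τ) a) =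
      ∑ p : Fin r → ι, ∑ q : Fin r → ι,
        (∏ a, c a (p a) (q a)) * ∏ a, A (i a) (p a) * A (i a) (q (τ⁻¹ a)) := by
    intro i
    simp_rw [hc, Fintype.prod_sum]
    refine Finset.sum_congr rfl fun p _ => Finset.sum_congr rfl fun q _ => ?_
    simp_rw [Finset.prod_mul_distrib]
    -- Reindexing by `τ` gathers both entries with row index `i a` in one factor, so the sum over
    -- `i` becomes a product of orthogonality relations.
    rw [← Equiv.prod_comp τ (fun a => A (i a) (q (τ⁻¹ a)))]
    simp [mul_comm]
  simp_rw [h1]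
  rw [Finset.sum_comm]
  refine Finset.sum_congr rfl fun p _ => ?_
  rw [Finset.sum_comm]
  simp_rw [← Finset.mul_sum]
  have h2 : ∀ q : Fin r → ι, ∑ i : Fin r → ι, ∏ a, A (i a) (p a) * A (i a) (q (τ⁻¹ a)) =
      if q = p ∘ τ then 1 else 0 := by
    intro q
    rw [← Fintype.prod_sum (fun a i => A i (p a) * A i (q (τ⁻¹ a)))]
    simp_rw [hA]
    rw [Finset.prod_ite_zero]
    simp only [Finset.prod_const_one]
    congr 1
    rw [eq_iff_iff]
    constructor
    · intro h
      ext a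
      simpa using (h (τ a) (Finset.mem_univ _)).symm
    · rintro rfl a _
      simp
  simp_rw [h2]
  simp

/-- The permutations of `Fin n` fixing every `k ≥ r` are the extensions of those of `Fin r`. -/
theorem sum_perm_fixing {n r : ℕ} (h : r ≤ n) (f : Equiv.Perm (Fin n) → ℝ) :
    (∑ κ : Equiv.Perm (Fin n), if ∀ k : Fin n, ¬ (k : ℕ) < r → κ k = k then f κ else 0) =
      ∑ ρ : Equiv.Perm (Fin r), f (ρ.extendDomain (Fin.castLEOrderIso h).toEquiv) := by
  rw [← Finset.sum_filter]
  let p : Fin n → Prop := fun k => (k : ℕ) < r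
  rw [Finset.sum_subtype (p := fun κ : Equiv.Perm (Fin n) => ∀ k, ¬ p k → κ k = k) _
    (by intro κ; simp [p])]
  refine (Fintype.sum_equiv ((Equiv.permCongr (Fin.castLEOrderIso h).toEquiv).trans
    (Equiv.Perm.subtypeEquivSubtypePerm p)) _ _ fun ρ => ?_).symm
  rfl

/-- These are the permutations of the remaining `n - r` indices; this count is the source of the
factor `(n - r)!`. -/
theorem card_perm_extending {n r : ℕ} (h : r ≤ n) :
    (Finset.univ.filter fun κ : Equiv.Perm (Fin n) => ∀ k : Fin n, (k : ℕ) < r → κ k = k).card =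
      (n - r).factorial := by
  let p : Fin n → Prop := fun k => ¬ (k : ℕ) < r
  have e := Equiv.Perm.subtypeEquivSubtypePerm p
  rw [← Fintype.card_subtype]
  have h2 : Fintype.card {a // p a} = n - r := by
    rw [Fintype.card_subtype_compl, Fintype.card_fin,
      Fintype.card_congr (Fin.castLEOrderIso h).toEquiv.symm, Fintype.card_fin]
  rw [← h2, ← Fintype.card_perm, Fintype.card_congr e]
  refine Fintype.card_congr (Equiv.subtypeEquivRight fun κ => ?_)
  simp [p]

/-- The fibre of restriction over an injective `i` is a coset of the stabilizer of the first `r`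
indices; over a non-injective `i` it is empty. -/
theorem sum_perm_restrict {n r : ℕ} (h : r ≤ n) (g : (Fin r → Fin n) → ℝ) :
    ∑ τ : Equiv.Perm (Fin n), g (τ ∘ Fin.castLE h) =
      ((n - r).factorial : ℝ) *
        ∑ i : Fin r → Fin n, (open Classical in if Function.Injective i then g i else 0) := by
  classical
  rw [Finset.mul_sum, ← Finset.sum_fiberwise (s := Finset.univ)
    (g := fun τ : Equiv.Perm (Fin n) => ⇑τ ∘ Fin.castLE h)]
  refine Finset.sum_congr rfl fun i _ => ?_
  rw [Finset.sum_congr rfl (g := fun _ => g i) (by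
    intro τ hτ
    rw [(Finset.mem_filter.mp hτ).2]), Finset.sum_const, nsmul_eq_mul]
  split_ifs with hi
  · congr 2
    obtain ⟨τ₀, hτ₀⟩ : ∃ τ₀ : Equiv.Perm (Fin n), ⇑τ₀ ∘ Fin.castLE h = i := by
      let e := (Equiv.ofInjective _ (Fin.castLE_injective h)).symm.trans (Equiv.ofInjective i hi)
      refine ⟨e.extendSubtype, ?_⟩
      ext1 k
      rw [Function.comp_apply, Equiv.extendSubtype_apply_of_mem e _ (Set.mem_range_self k)]
      have : (⟨Fin.castLE h k, Set.mem_range_self k⟩ : Set.range (Fin.castLE h)) =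
        Equiv.ofInjective _ (Fin.castLE_injective h) k := rfl
      simp only [e]
      rw [Equiv.trans_apply, this, Equiv.symm_apply_apply, Equiv.ofInjective_apply]
    rw [← card_perm_extending h]
    refine Finset.card_equiv (Equiv.mulLeft τ₀⁻¹) fun τ => ?_
    simp only [Finset.mem_filter, Finset.mem_univ, true_and, Equiv.coe_mulLeft,
      Equiv.Perm.coe_mul, Function.comp_apply, Equiv.Perm.inv_eq_iff_eq]
    rw [← hτ₀]
    constructor
    · intro h1 k hk
      exact congrFun h1 ⟨k, hk⟩
    · intro h1
      ext1 k
      exact h1 (Fin.castLE h k) k.2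
  · rw [Finset.filter_eq_empty_iff.mpr]
    · simp
    · rintro τ - rfl
      exact hi (τ.injective.comp (Fin.castLE_injective h))

/-- Expansion of the Brito-Naveira determinant sum. -/
theorem sum_sign_mul_det {n r : ℕ} (h : r ≤ n) (c : Fin r → Fin n → Fin n → ℝ) :
    ∑ σ : Equiv.Perm (Fin n), ((Equiv.Perm.sign σ : ℤ) : ℝ) *
      Matrix.det (Matrix.of fun k b : Fin n =>
        if hk : (k : ℕ) < r then c ⟨k, hk⟩ b (σ k) else if σ k = b then (1 : ℝ) else 0) =
    ((n - r).factorial : ℝ) *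
      ∑ i, ∑ j, kroneckerSymbol i j * ∏ a, c a (i a) (j a) := by
  classical
  -- Leibniz expansion: the permutation-matrix rows force `τ` to agree with `σ` from place `r` on.
  have key : ∀ σ : Equiv.Perm (Fin n), Matrix.det (Matrix.of fun k b : Fin n =>
        if hk : (k : ℕ) < r then c ⟨k, hk⟩ b (σ k) else if σ k = b then (1 : ℝ) else 0) =
      ∑ τ : Equiv.Perm (Fin n), ((Equiv.Perm.sign τ : ℤ) : ℝ) *
        if ∀ k : Fin n, ¬ (k : ℕ) < r → σ k = τ k then
          ∏ a : Fin r, c a (τ (Fin.castLE h a)) (σ (Fin.castLE h a)) else 0 := by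
    intro σ
    rw [← Matrix.det_transpose, Matrix.det_apply']
    refine Finset.sum_congr rfl fun τ _ => ?_
    congr 1
    simp only [Matrix.transpose_apply, Matrix.of_apply]
    obtain ⟨t, rfl⟩ := Nat.exists_eq_add_of_le h
    rw [Fin.prod_univ_add]
    simp only [Fin.val_castAdd, Fin.is_lt, dite_true, Fin.eta, Fin.val_natAdd,
      add_lt_iff_neg_left, not_lt_zero, dite_false]
    rw [Finset.prod_ite_zero]
    simp only [Finset.prod_const_one, mul_ite, mul_one, mul_zero]
    refine if_congr ?_ rfl rfl
    constructor
    · intro h1 k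
      refine Fin.addCases (fun a ha => ?_) (fun a _ => ?_) k
      · exact absurd a.2 ha
      · exact h1 a (Finset.mem_univ _)
    · intro h1 a _
      exact h1 _ (by simp)
  simp_rw [key, Finset.mul_sum]
  rw [Finset.sum_comm]
  have step : ∀ τ : Equiv.Perm (Fin n),
      (∑ σ : Equiv.Perm (Fin n), ((Equiv.Perm.sign σ : ℤ) : ℝ) *
        (((Equiv.Perm.sign τ : ℤ) : ℝ) * if ∀ k : Fin n, ¬ (k : ℕ) < r → σ k = τ k then
          ∏ a : Fin r, c a (τ (Fin.castLE h a)) (σ (Fin.castLE h a)) else 0)) =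
      ∑ ρ : Equiv.Perm (Fin r), ((Equiv.Perm.sign ρ : ℤ) : ℝ) *
        ∏ a : Fin r, c a ((τ ∘ Fin.castLE h) a) ((τ ∘ Fin.castLE h) (ρ a)) := by
    intro τ
    -- Substituting `σ = τκ` turns the agreement condition into `κ` fixing every place from `r` on,
    -- and the two signs of `τ` cancel.
    rw [← Equiv.sum_comp (Equiv.mulLeft τ)]
    have := sum_perm_fixing h (fun κ => ((Equiv.Perm.sign κ : ℤ) : ℝ) *
      ∏ a : Fin r, c a (τ (Fin.castLE h a)) (τ (κ (Fin.castLE h a))))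
    trans
    swap
    · refine this.trans (Finset.sum_congr rfl fun ρ _ => ?_)
      rw [Equiv.Perm.sign_extendDomain]
      congr 1
      refine Finset.prod_congr rfl fun a _ => ?_
      congr 2
      exact Equiv.Perm.extendDomain_apply_image ρ (Fin.castLEOrderIso h).toEquiv a
    · refine Finset.sum_congr rfl fun κ _ => ?_
      have hs : ((Equiv.Perm.sign τ : ℤ) : ℝ) * ((Equiv.Perm.sign τ : ℤ) : ℝ) = 1 := by
        rw [← Int.cast_mul, ← Units.val_mul, Int.units_mul_self]
        simp
      simp only [Equiv.coe_mulLeft, Equiv.Perm.sign_mul, Equiv.Perm.coe_mul, Function.comp_apply,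
        EmbeddingLike.apply_eq_iff_eq, Units.val_mul, Int.cast_mul]
      split_ifs
      · linear_combination (((Equiv.Perm.sign κ : ℤ) : ℝ) *
          ∏ a : Fin r, c a (τ (Fin.castLE h a)) (τ (κ (Fin.castLE h a)))) * hs
      · simp
  simp_rw [step]
  rw [sum_perm_restrict h (fun i => ∑ ρ : Equiv.Perm (Fin r), ((Equiv.Perm.sign ρ : ℤ) : ℝ) *
        ∏ a : Fin r, c a (i a) (i (ρ a)))]
  simp_rw [← Finset.mul_sum]
  congr 1
  refine Finset.sum_congr rfl fun i _ => ?_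
  unfold kroneckerSymbol
  split_ifs with hi
  · simp_rw [Finset.sum_mul]
    rw [Finset.sum_comm]
    refine Finset.sum_congr rfl fun ρ _ => ?_
    simp
  · simp

/-- Every shuffle class but the trivial one feeds some vector of the first block to the second
factor, where it gives a zero row in the determinant. -/
theorem wedge_wedgeCovectors_apply {V : Type*} [AddCommGroup V] [Module ℝ V] {p q : ℕ}
    (a : V [⋀^Fin p]→ₗ[ℝ] ℝ) (ζ : Fin q → Dual ℝ V) (v : Fin (p + q) → V)
    (h0 : ∀ α i, ζ α (v (Fin.castAdd q i)) = 0)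
    (h1 : ∀ α β, ζ α (v (Fin.natAdd p β)) = if α = β then 1 else 0) :
    wedge a (wedgeCovectors ζ) v = a fun i => v (Fin.castAdd q i) := by
  have hz : ∀ w : Fin q → V, wedgeCovectors ζ w = Matrix.det (Matrix.of fun β α => ζ α (w β)) := by
    intro w
    rfl
  simp only [wedge, AlternatingMap.domDomCongr_apply, LinearMap.compAlternatingMap_apply,
    AlternatingMap.domCoprod_apply, sum_apply, map_sum]
  refine (Fintype.sum_eq_single (Quotient.mk'' 1 : Equiv.Perm.ModSumCongr (Fin p) (Fin q))
    fun σ hσ => ?_).trans ?_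
  · induction σ using Quotient.inductionOn' with | _ σ
    rw [AlternatingMap.domCoprod.summand_mk'']
    simp only [smul_apply, MultilinearMap.domDomCongr_apply, MultilinearMap.domCoprod_apply]
    by_cases hr : ∀ α : Fin q, ∃ β : Fin q, σ (Sum.inr α) = Sum.inr β
    · exfalso
      -- Preserving the right block means preserving the left one, so `σ` lies in the trivial class.
      apply hσ
      refine Quotient.sound' ?_
      rw [QuotientGroup.leftRel_apply, mul_one]
      refine inv_mem (Equiv.Perm.mem_sumCongrHom_range_of_perm_mapsTo_inl ?_)
      rw [Equiv.Perm.perm_mapsTo_inl_iff_mapsTo_inr]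
      rintro _ ⟨α, rfl⟩
      obtain ⟨β, hβ⟩ := hr α
      exact ⟨β, hβ.symm⟩
    · push Not at hr
      obtain ⟨α, hα⟩ := hr
      obtain ⟨i, hi⟩ : ∃ i, σ (Sum.inr α) = Sum.inl i := by
        rcases h : σ (Sum.inr α) with i | β
        · exact ⟨i, rfl⟩
        · exact absurd h (hα β)
      have : wedgeCovectors ζ
          (fun β => (v ∘ finSumFinEquiv) (σ (Sum.inr β))) = 0 := by
        rw [hz]
        refine Matrix.det_eq_zero_of_row_eq_zero α fun β => ?_
        simp [hi, h0]
      simp only [Function.comp_apply] at this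
      simp [this]
  · rw [AlternatingMap.domCoprod.summand_mk'']
    have h2 : wedgeCovectors ζ (fun β => v (Fin.natAdd p β)) = 1 := by
      rw [hz, ← Matrix.det_one (n := Fin q)]
      congr 1
      ext α β
      simp [h1, Matrix.one_apply, eq_comm]
    simp [h2]

/-- Pairs the two places that share one normal index `β k`. -/
theorem prod_fin_two_mul {s : ℕ} (f : Fin (2 * s) → ℝ) :
    ∏ a, f a = ∏ k : Fin s, f ⟨2 * k, by omega⟩ * f ⟨2 * k + 1, by omega⟩ := by
  let e : Fin s × Fin 2 ≃ Fin (2 * s) :=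
    { toFun := fun x => ⟨2 * x.1 + x.2, by omega⟩
      invFun := fun a => (⟨a / 2, by omega⟩, ⟨a % 2, by omega⟩)
      left_inv := by
        rintro ⟨k, t⟩
        ext <;> simp <;> omega
      right_inv := by
        intro a
        ext
        simp
        omega }
  rw [← e.prod_comp, Fintype.prod_prod_type]
  refine Finset.prod_congr rfl fun k _ => ?_
  rw [Fin.prod_univ_two]
  rfl

end Algebra

theorem alternatingMap_sum_apply {V κ ι : Type*} [AddCommGroup V] [Module ℝ V] (t : Finset κ)
    (f : κ → V [⋀^ι]→ₗ[ℝ] ℝ) (v : ι → V) : (∑ i ∈ t, f i) v = ∑ i ∈ t, f i v := by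
  classical
  induction t using Finset.induction_on with
  | empty => simp
  | insert i t hi ih => rw [Finset.sum_insert hi, Finset.sum_insert hi, ← ih]; rfl

/-! ### Frame independence of `S_r` and the pointwise identity -/

section Pointwise

variable {n l : ℕ} {M : Type*} [TopologicalSpace M]
  [ChartedSpace (EuclideanSpace ℝ (Fin (n + l))) M] [IsManifold (𝓡 (n + l)) ∞ M]
  [RiemannianBundle (fun x : M => TangentSpace (𝓡 (n + l)) x)]
  {D : ∀ x : M, Submodule ℝ (TangentSpace (𝓡 (n + l)) x)} {U : Set M}
  {e : Fin (n + l) → ∀ x : M, TangentSpace (𝓡 (n + l)) x}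

/-- The orthonormal basis of the tangent space at `x` given by an orthonormal family of
full size. -/
def orthonormalBasisOfFrame {x : M} {v : Fin (n + l) → TangentSpace (𝓡 (n + l)) x}
    (h : Orthonormal ℝ v) : OrthonormalBasis (Fin (n + l)) ℝ (TangentSpace (𝓡 (n + l)) x) :=
  OrthonormalBasis.mk h (by
    rw [h.linearIndependent.span_eq_top_of_card_eq_finrank'
      (by rw [Fintype.card_fin, (instFactFinrankTangentSpace x).out])])

@[simp]
theorem coe_orthonormalBasisOfFrame {x : M} {v : Fin (n + l) → TangentSpace (𝓡 (n + l)) x}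
    (h : Orthonormal ℝ v) : ⇑(orthonormalBasisOfFrame h) = v :=
  OrthonormalBasis.coe_mk _ _

theorem IsPositiveBasis.orientation_orthonormalBasisOfFrame {x : M}
    {o : Orientation ℝ (TangentSpace (𝓡 (n + l)) x) (Fin (n + l))}
    {v : Fin (n + l) → TangentSpace (𝓡 (n + l)) x} (hpos : IsPositiveBasis o v)
    (h : Orthonormal ℝ v) : (orthonormalBasisOfFrame h).toBasis.orientation = o := by
  obtain ⟨b, hb, rfl⟩ := hpos
  congr 1
  apply Basis.eq_of_apply_eq
  intro A
  simp [hb]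

namespace IsAdaptedFrame

theorem sum_inner_smul (he : IsAdaptedFrame D U e) {x : M} (hx : x ∈ U)
    (w : TangentSpace (𝓡 (n + l)) x) :
    w = ∑ i : Fin n, inner ℝ (e (Fin.castAdd l i) x) w • e (Fin.castAdd l i) x +
      ∑ α : Fin l, inner ℝ (e (Fin.natAdd n α) x) w • e (Fin.natAdd n α) x := by
  conv_lhs => rw [← (orthonormalBasisOfFrame (he.orthonormal x hx)).sum_repr' w]
  rw [Fin.sum_univ_add]
  simp

theorem orthonormal_normal (he : IsAdaptedFrame D U e) {x : M} (hx : x ∈ U) :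
    Orthonormal ℝ fun α : Fin l => e (Fin.natAdd n α) x :=
  (he.orthonormal x hx).comp _ (Fin.natAdd_injective l n)

theorem starProjection_orthogonal (he : IsAdaptedFrame D U e) {x : M} (hx : x ∈ U)
    (w : TangentSpace (𝓡 (n + l)) x) :
    (D x)ᗮ.starProjection w =
      ∑ α : Fin l, inner ℝ (e (Fin.natAdd n α) x) w • e (Fin.natAdd n α) x := by
  refine Submodule.eq_starProjection_of_mem_orthogonal' (z :=
    ∑ i : Fin n, inner ℝ (e (Fin.castAdd l i) x) w • e (Fin.castAdd l i) x) ?_ ?_ ?_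
  · exact Submodule.sum_mem _ fun α _ => Submodule.smul_mem _ _ (he.normal x hx α)
  · exact Submodule.le_orthogonal_orthogonal _
      (Submodule.sum_mem _ fun i _ => Submodule.smul_mem _ _ (he.tangent x hx i))
  · exact (he.sum_inner_smul hx w).trans (add_comm _ _)

theorem sum_tangent (he : IsAdaptedFrame D U e) {x : M} (hx : x ∈ U)
    {w : TangentSpace (𝓡 (n + l)) x} (hw : w ∈ D x) :
    w = ∑ i : Fin n, inner ℝ (e (Fin.castAdd l i) x) w • e (Fin.castAdd l i) x := by
  conv_lhs => rw [he.sum_inner_smul hx w]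
  rw [add_eq_left]
  refine Finset.sum_eq_zero fun α _ => ?_
  rw [real_inner_comm, Submodule.inner_right_of_mem_orthogonal hw (he.normal x hx α), zero_smul]

end IsAdaptedFrame

variable (cov : CovariantDerivative (𝓡 (n + l)) (EuclideanSpace ℝ (Fin (n + l)))
      (fun x : M => TangentSpace (𝓡 (n + l)) x))

/-- `S_r` in terms of the components of `∇_{e_i} e_j` with respect to an orthonormal basis of the
normal space. -/
theorem frameMeanCurvature_eq {x : M} {f : Fin l → TangentSpace (𝓡 (n + l)) x}
    (hf : Orthonormal ℝ f)
    (hP : ∀ w, (D x)ᗮ.starProjection w = ∑ α, inner ℝ (f α) w • f α) (s : ℕ)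
    (e : Fin (n + l) → ∀ x : M, TangentSpace (𝓡 (n + l)) x) :
    frameMeanCurvature cov D s e x = (1 / ((2 * s).factorial : ℝ)) *
      ∑ β : Fin s → Fin l, ∑ i : Fin (2 * s) → Fin n, ∑ j : Fin (2 * s) → Fin n,
        kroneckerSymbol i j * ∏ a : Fin (2 * s), inner ℝ (f (β ⟨a / 2, by omega⟩))
          (cov (e (Fin.castAdd l (j a))) x (e (Fin.castAdd l (i a)) x)) := by
  have hin : ∀ u v, inner ℝ ((D x)ᗮ.starProjection u) ((D x)ᗮ.starProjection v) =
      ∑ α, inner ℝ (f α) u * inner ℝ (f α) v := by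
    intro u v
    rw [hP, hP, hf.inner_sum]
    simp
  unfold frameMeanCurvature secondFundamentalForm
  simp only [hin]
  congr 1
  rw [Finset.sum_comm (γ := Fin s → Fin l)]
  refine Finset.sum_congr rfl fun i _ => ?_
  rw [Finset.sum_comm (γ := Fin s → Fin l)]
  refine Finset.sum_congr rfl fun j _ => ?_
  rw [← Finset.mul_sum, Fintype.prod_sum]
  congr 1
  refine Finset.sum_congr rfl fun β _ => ?_
  rw [prod_fin_two_mul]
  refine Finset.prod_congr rfl fun k _ => ?_
  have h1 : (⟨2 * (k : ℕ) / 2, by omega⟩ : Fin s) = k := Fin.ext (by simp)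
  have h2 : (⟨(2 * (k : ℕ) + 1) / 2, by omega⟩ : Fin s) = k := Fin.ext (by simp; omega)
  simp only [h1, h2]

theorem IsSmoothFieldOn.mdifferentiableAt {X : ∀ x : M, TangentSpace (𝓡 (n + l)) x}
    (hX : IsSmoothFieldOn X U) (hU : IsOpen U) {x : M} (hx : x ∈ U) :
    MDifferentiableAt (𝓡 (n + l)) (𝓡 (n + l)).tangent
      (fun x => (⟨x, X x⟩ : TangentBundle (𝓡 (n + l)) M)) x :=
  ((hX x hx).contMDiffAt (hU.mem_nhds hx)).mdifferentiableAt (by simp)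

theorem mdifferentiableAt_smul_field {g : M → ℝ} {X : ∀ x : M, TangentSpace (𝓡 (n + l)) x} {x : M}
    (hg : MDifferentiableAt (𝓡 (n + l)) 𝓘(ℝ, ℝ) g x)
    (hX : MDifferentiableAt (𝓡 (n + l)) (𝓡 (n + l)).tangent
      (fun x => (⟨x, X x⟩ : TangentBundle (𝓡 (n + l)) M)) x) :
    MDifferentiableAt (𝓡 (n + l)) (𝓡 (n + l)).tangent
      (fun x => (⟨x, (g • X) x⟩ : TangentBundle (𝓡 (n + l)) M)) x :=
  MDifferentiableAt.smul_section hg hX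

theorem mdifferentiableAt_sum_smul_field {ι : Type*} (t : Finset ι) {g : ι → M → ℝ}
    {X : ι → ∀ x : M, TangentSpace (𝓡 (n + l)) x} {x : M}
    (hg : ∀ i, MDifferentiableAt (𝓡 (n + l)) 𝓘(ℝ, ℝ) (g i) x)
    (hX : ∀ i, MDifferentiableAt (𝓡 (n + l)) (𝓡 (n + l)).tangent
      (fun x => (⟨x, X i x⟩ : TangentBundle (𝓡 (n + l)) M)) x) :
    MDifferentiableAt (𝓡 (n + l)) (𝓡 (n + l)).tangent
      (fun x => (⟨x, (∑ i ∈ t, g i • X i) x⟩ : TangentBundle (𝓡 (n + l)) M)) x := by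
  simp only [Finset.sum_apply]
  exact MDifferentiableAt.sum_section fun i _ => mdifferentiableAt_smul_field (hg i) (hX i)

/-- A linear functional that vanishes on the `X i` sees `∇ (∑ g i • X i)` as if `∇` were linear
over functions. -/
theorem apply_cov_sum_smul {ι : Type*} (t : Finset ι) {g : ι → M → ℝ}
    {X : ι → ∀ x : M, TangentSpace (𝓡 (n + l)) x} {x : M}
    (hg : ∀ i, MDifferentiableAt (𝓡 (n + l)) 𝓘(ℝ, ℝ) (g i) x)
    (hX : ∀ i, MDifferentiableAt (𝓡 (n + l)) (𝓡 (n + l)).tangent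
      (fun x => (⟨x, X i x⟩ : TangentBundle (𝓡 (n + l)) M)) x)
    (Q : TangentSpace (𝓡 (n + l)) x →ₗ[ℝ] ℝ) (hQ : ∀ i, Q (X i x) = 0)
    (v : TangentSpace (𝓡 (n + l)) x) :
    Q (cov (∑ i ∈ t, g i • X i) x v) = ∑ i ∈ t, g i x * Q (cov (X i) x v) := by
  classical
  induction t using Finset.induction_on with
  | empty => simp
  | insert i t hi ih =>
    rw [Finset.sum_insert hi, Finset.sum_insert hi, ← ih,
      cov.isCovariantDerivativeOnUniv.add (mdifferentiableAt_smul_field (hg i) (hX i))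
        (mdifferentiableAt_sum_smul_field t hg hX),
      cov.isCovariantDerivativeOnUniv.leibniz (hX i) (hg i)]
    simp [hQ]

variable [IsContMDiffRiemannianBundle (𝓡 (n + l)) ∞ (EuclideanSpace ℝ (Fin (n + l)))
      (fun x : M => TangentSpace (𝓡 (n + l)) x)]

theorem IsSmoothFieldOn.inner {X Y : ∀ x : M, TangentSpace (𝓡 (n + l)) x}
    (hX : IsSmoothFieldOn X U) (hY : IsSmoothFieldOn Y U) :
    ContMDiffOn (𝓡 (n + l)) 𝓘(ℝ, ℝ) ∞ (fun x => inner ℝ (X x) (Y x)) U :=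
  ContMDiffOn.inner_bundle (b := id) hX hY

/-- `S_r` does not depend on the adapted frame. -/
theorem frameMeanCurvature_eq_of_isAdaptedFrame {U' : Set M}
    {e' : Fin (n + l) → ∀ x : M, TangentSpace (𝓡 (n + l)) x} (he : IsAdaptedFrame D U e)
    (he' : IsAdaptedFrame D U' e') (s : ℕ) {x : M} (hx : x ∈ U) (hx' : x ∈ U') :
    frameMeanCurvature cov D s e' x = frameMeanCurvature cov D s e x := by
  -- Both sides are expanded in the normal vectors of the same frame `e`, so only the tangent frame
  -- changes.
  rw [frameMeanCurvature_eq cov (he.orthonormal_normal hx) (he.starProjection_orthogonal hx),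
    frameMeanCurvature_eq cov (he.orthonormal_normal hx) (he.starProjection_orthogonal hx)]
  congr 1
  refine Finset.sum_congr rfl fun β _ => ?_
  set A : Fin n → Fin n → ℝ := fun i p =>
    inner ℝ (e (Fin.castAdd l p) x) (e' (Fin.castAdd l i) x) with hA
  refine sum_kroneckerSymbol_orthogonal A ?_
    (fun a i j => inner ℝ (e (Fin.natAdd n (β ⟨a / 2, by omega⟩)) x)
      (cov (e (Fin.castAdd l j)) x (e (Fin.castAdd l i) x)))
    (fun a i j => inner ℝ (e (Fin.natAdd n (β ⟨a / 2, by omega⟩)) x)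
      (cov (e' (Fin.castAdd l j)) x (e' (Fin.castAdd l i) x))) ?_
  · intro p q
    have h1 := he'.sum_tangent hx' (he.tangent x hx q)
    have h2 : inner ℝ (e (Fin.castAdd l p) x) (e (Fin.castAdd l q) x) =
        if p = q then (1 : ℝ) else 0 := by
      have := orthonormal_iff_ite.mp (he.orthonormal x hx) (Fin.castAdd l p) (Fin.castAdd l q)
      simpa using this
    rw [← h2]
    conv_rhs => rw [h1]
    rw [inner_sum]
    refine Finset.sum_congr rfl fun i _ => ?_
    rw [inner_smul_right, real_inner_comm, mul_comm, hA]
  · intro a i j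
    generalize (⟨(a : ℕ) / 2, by omega⟩ : Fin s) = k
    set Q : TangentSpace (𝓡 (n + l)) x →ₗ[ℝ] ℝ := innerₗ _ (e (Fin.natAdd n (β k)) x) with hQ
    have hQ0 : ∀ q : Fin n, Q (e (Fin.castAdd l q) x) = 0 := fun q => by
      rw [hQ, innerₗ_apply_apply, real_inner_comm,
        Submodule.inner_right_of_mem_orthogonal (he.tangent x hx q) (he.normal x hx _)]
    have hg : ∀ q : Fin n, MDifferentiableAt (𝓡 (n + l)) 𝓘(ℝ, ℝ)
        (fun y => inner ℝ (e (Fin.castAdd l q) y) (e' (Fin.castAdd l j) y)) x := fun q =>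
      (((IsSmoothFieldOn.inner (U := U ∩ U') ((he.smooth _).mono Set.inter_subset_left)
        ((he'.smooth _).mono Set.inter_subset_right)) x ⟨hx, hx'⟩).contMDiffAt
        ((he.isOpen.inter he'.isOpen).mem_nhds ⟨hx, hx'⟩)).mdifferentiableAt (by simp)
    have hX : ∀ q : Fin n, MDifferentiableAt (𝓡 (n + l)) (𝓡 (n + l)).tangent
        (fun x => (⟨x, e (Fin.castAdd l q) x⟩ : TangentBundle (𝓡 (n + l)) M)) x := fun q =>
      (he.smooth _).mdifferentiableAt he.isOpen hx
    -- The expansion of `e'_j` in the tangent fields of `e` is only known on `U ∩ U'`; locality of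
    -- the connection makes this enough.
    have h1 : cov (e' (Fin.castAdd l j)) x = cov (∑ q : Fin n,
        (fun y => inner ℝ (e (Fin.castAdd l q) y) (e' (Fin.castAdd l j) y)) •
          e (Fin.castAdd l q)) x := by
      refine cov.isCovariantDerivativeOnUniv.congr_of_eventuallyEq
        ((he'.smooth _).mdifferentiableAt he'.isOpen hx')
        (mdifferentiableAt_sum_smul_field _ hg hX) Filter.univ_mem ?_
      filter_upwards [(he.isOpen.inter he'.isOpen).mem_nhds ⟨hx, hx'⟩] with y hy
      conv_lhs => rw [he.sum_tangent hy.1 (he'.tangent y hy.2 j)]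
      simp
    have h2 : ∀ v, Q (cov (e' (Fin.castAdd l j)) x v) =
        ∑ q, A j q * Q (cov (e (Fin.castAdd l q)) x v) := fun v => by
      rw [h1, apply_cov_sum_smul cov _ hg hX Q hQ0]
    change Q _ = ∑ p, ∑ q, A i p * A j q * Q _
    rw [h2, Finset.sum_comm]
    refine Finset.sum_congr rfl fun q _ => ?_
    conv_lhs => rw [he.sum_tangent hx (he'.tangent x hx' i)]
    rw [map_sum, map_sum, Finset.mul_sum]
    refine Finset.sum_congr rfl fun p _ => ?_
    rw [map_smul, map_smul, smul_eq_mul]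
    ring

theorem meanCurvature_eq (he : IsAdaptedFrame D U e) (s : ℕ) {x : M} (hx : x ∈ U) :
    meanCurvature cov D s x = frameMeanCurvature cov D s e x := by
  have h : ∃ e : Fin (n + l) → ∀ x : M, TangentSpace (𝓡 (n + l)) x,
      ∃ U : Set M, x ∈ U ∧ IsAdaptedFrame D U e := ⟨e, U, hx, he⟩
  rw [meanCurvature, dif_pos h]
  obtain ⟨U', hx', he'⟩ := h.choose_spec
  exact frameMeanCurvature_eq_of_isAdaptedFrame cov he he' s hx hx'

/-- On the frame, `ν` drops out and `sum_sign_mul_det` applies for each fixed `β`. -/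
theorem wedge_gammaForm_apply (he : IsAdaptedFrame D U e) {s : ℕ} (hs : 2 * s ≤ n) {x : M}
    (hx : x ∈ U) :
    (1 / (((2 * s).factorial : ℝ) * ((n - 2 * s).factorial : ℝ))) *
      wedge (gammaForm cov s e x) (transverseForm e x) (fun A => e A x) =
    frameMeanCurvature cov D s e x := by
  have hort := orthonormal_iff_ite.mp (he.orthonormal x hx)
  rw [transverseForm, wedge_wedgeCovectors_apply]
  rotate_left
  · intro α i
    have hne : Fin.natAdd n α ≠ Fin.castAdd l i := fun h => by
      have := congrArg Fin.val h
      simp only [Fin.val_natAdd, Fin.val_castAdd] at this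
      omega
    simpa [coframe, hne] using hort (Fin.natAdd n α) (Fin.castAdd l i)
  · intro α β
    simpa [coframe] using hort (Fin.natAdd n α) (Fin.natAdd n β)
  rw [frameMeanCurvature_eq cov (he.orthonormal_normal hx) (he.starProjection_orthogonal hx)]
  have h1 : gammaForm cov s e x (fun i => e (Fin.castAdd l i) x) =
      ∑ β : Fin s → Fin l, ∑ σ : Equiv.Perm (Fin n), ((Equiv.Perm.sign σ : ℤ) : ℝ) *
        Matrix.det (Matrix.of fun k b : Fin n =>
          if hk : (k : ℕ) < 2 * s then
            (fun (a : Fin (2 * s)) (i j : Fin n) =>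
              -inner ℝ (e (Fin.natAdd n (β ⟨a / 2, by omega⟩)) x)
              (cov (e (Fin.castAdd l j)) x (e (Fin.castAdd l i) x))) ⟨k, hk⟩ b (σ k)
          else if σ k = b then (1 : ℝ) else 0) := by
    rw [gammaForm, Finset.sum_comm]
    simp only [alternatingMap_sum_apply]
    refine Finset.sum_congr rfl fun β _ => Finset.sum_congr rfl fun σ _ => ?_
    rw [AlternatingMap.smul_apply, smul_eq_mul]
    congr 1
    rw [← Matrix.det_transpose]
    change Matrix.det _ = _
    congr 1
    ext k b
    simp only [LinearMap.pi_apply, Matrix.transpose_apply, Matrix.of_apply]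
    split_ifs with h1 h2
    · rfl
    · simpa [coframe, h2] using hort (Fin.castAdd l (σ b)) (Fin.castAdd l k)
    · simpa [coframe, h2] using hort (Fin.castAdd l (σ b)) (Fin.castAdd l k)
  have h2 := fun β : Fin s → Fin l => sum_sign_mul_det hs
    (fun (a : Fin (2 * s)) (i j : Fin n) =>
              -inner ℝ (e (Fin.natAdd n (β ⟨a / 2, by omega⟩)) x)
              (cov (e (Fin.castAdd l j)) x (e (Fin.castAdd l i) x)))
  rw [h1, Finset.sum_congr rfl fun β _ => h2 β, ← Finset.mul_sum]
  -- The minus signs of the `2 * s` connection forms cancel.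
  have h3 : ∀ f : Fin (2 * s) → ℝ, ∏ a, -f a = ∏ a, f a := fun f => by
    rw [Finset.prod_neg]
    simp
  simp only [h3]
  have h4 : ((n - 2 * s).factorial : ℝ) ≠ 0 := by positivity
  field_simp

theorem smul_wedge_gammaForm (o : ∀ x : M, Orientation ℝ (TangentSpace (𝓡 (n + l)) x) (Fin (n + l)))
    (he : IsAdaptedFrame D U e) {s : ℕ} (hs : 2 * s ≤ n) {x : M} (hx : x ∈ U)
    (hpos : IsPositiveBasis (o x) (fun A => e A x)) :
    (1 / (((2 * s).factorial : ℝ) * ((n - 2 * s).factorial : ℝ))) •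
        wedge (gammaForm cov s e x) (transverseForm e x) =
      meanCurvature cov D s x • (o x).volumeForm := by
  set b := orthonormalBasisOfFrame (he.orthonormal x hx) with hb
  have hbo : b.toBasis.orientation = o x := hpos.orientation_orthonormalBasisOfFrame _
  rw [AlternatingMap.eq_smul_basis_det b.toBasis (_ • wedge _ _), meanCurvature_eq cov he s hx,
    (o x).volumeForm_robust b hbo, ← wedge_gammaForm_apply cov he hs hx]
  congr 1
  simp [hb]

end Pointwise

/-! ### Existence of positive adapted frames and continuity of `S_r` -/

section Frames

variable {n l : ℕ} {M : Type*} [TopologicalSpace M]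
  [ChartedSpace (EuclideanSpace ℝ (Fin (n + l))) M] [IsManifold (𝓡 (n + l)) ∞ M]

theorem IsSmoothFieldOn.sub {X Y : ∀ x : M, TangentSpace (𝓡 (n + l)) x} {U : Set M}
    (hX : IsSmoothFieldOn X U) (hY : IsSmoothFieldOn Y U) :
    IsSmoothFieldOn (fun x => X x - Y x) U :=
  ContMDiffOn.sub_section hX hY

theorem IsSmoothFieldOn.smul {X : ∀ x : M, TangentSpace (𝓡 (n + l)) x} {U : Set M} {g : M → ℝ}
    (hg : ContMDiffOn (𝓡 (n + l)) 𝓘(ℝ, ℝ) ∞ g U) (hX : IsSmoothFieldOn X U) :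
    IsSmoothFieldOn (fun x => g x • X x) U :=
  ContMDiffOn.smul_section hg hX

theorem IsSmoothFieldOn.sum {ι : Type*} {t : Finset ι}
    {X : ι → ∀ x : M, TangentSpace (𝓡 (n + l)) x} {U : Set M}
    (hX : ∀ i ∈ t, IsSmoothFieldOn (X i) U) : IsSmoothFieldOn (fun x => ∑ i ∈ t, X i x) U :=
  ContMDiffOn.sum_section hX

variable [RiemannianBundle (fun x : M => TangentSpace (𝓡 (n + l)) x)]
  [IsContMDiffRiemannianBundle (𝓡 (n + l)) ∞ (EuclideanSpace ℝ (Fin (n + l)))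
      (fun x : M => TangentSpace (𝓡 (n + l)) x)]

/-- The Gram-Schmidt process applied to a smooth frame yields smooth fields. -/
theorem isSmoothFieldOn_gramSchmidt {m : ℕ} {f : Fin m → ∀ x : M, TangentSpace (𝓡 (n + l)) x}
    {U : Set M} (hf : ∀ A, IsSmoothFieldOn (f A) U)
    (hli : ∀ x ∈ U, LinearIndependent ℝ fun A => f A x) (A : Fin m) :
    IsSmoothFieldOn (fun x => InnerProductSpace.gramSchmidt ℝ (fun A => f A x) A) U := by
  induction A using WellFoundedLT.induction with
  | ind A ih =>
    have h1 : (fun x => InnerProductSpace.gramSchmidt ℝ (fun A => f A x) A) = fun x =>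
        f A x - ∑ i ∈ Finset.Iio A,
          (inner ℝ (InnerProductSpace.gramSchmidt ℝ (fun A => f A x) i) (f A x) /
            inner ℝ (InnerProductSpace.gramSchmidt ℝ (fun A => f A x) i)
              (InnerProductSpace.gramSchmidt ℝ (fun A => f A x) i)) •
            InnerProductSpace.gramSchmidt ℝ (fun A => f A x) i := by
      funext x
      have := InnerProductSpace.gramSchmidt_def'' ℝ (fun A => f A x) A
      simp only [real_inner_self_eq_norm_sq]
      exact eq_sub_of_add_eq this.symm
    rw [h1]
    refine (hf A).sub (IsSmoothFieldOn.sum fun i hi => ?_)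
    have hi' := ih i (Finset.mem_Iio.mp hi)
    refine IsSmoothFieldOn.smul (ContMDiffOn.div₀ (hi'.inner (hf A)) (hi'.inner hi') ?_) hi'
    intro x hx
    exact inner_self_ne_zero.mpr (InnerProductSpace.gramSchmidt_ne_zero i (hli x hx))

theorem isSmoothFieldOn_gramSchmidtNormed {m : ℕ}
    {f : Fin m → ∀ x : M, TangentSpace (𝓡 (n + l)) x}
    {U : Set M} (hf : ∀ A, IsSmoothFieldOn (f A) U)
    (hli : ∀ x ∈ U, LinearIndependent ℝ fun A => f A x) (A : Fin m) :
    IsSmoothFieldOn (fun x => InnerProductSpace.gramSchmidtNormed ℝ (fun A => f A x) A) U := by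
  have h := isSmoothFieldOn_gramSchmidt hf hli A
  have hne : ∀ x ∈ U, inner ℝ (InnerProductSpace.gramSchmidt ℝ (fun A => f A x) A)
      (InnerProductSpace.gramSchmidt ℝ (fun A => f A x) A) ≠ 0 := fun x hx =>
    inner_self_ne_zero.mpr (InnerProductSpace.gramSchmidt_ne_zero A (hli x hx))
  have h1 : (fun x => InnerProductSpace.gramSchmidtNormed ℝ (fun A => f A x) A) = fun x =>
      (Real.sqrt (inner ℝ (InnerProductSpace.gramSchmidt ℝ (fun A => f A x) A)
        (InnerProductSpace.gramSchmidt ℝ (fun A => f A x) A)))⁻¹ •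
          InnerProductSpace.gramSchmidt ℝ (fun A => f A x) A := by
    funext x
    rw [← norm_eq_sqrt_real_inner]
    rfl
  rw [h1]
  refine IsSmoothFieldOn.smul (ContMDiffOn.inv₀ ?_ fun x hx => ?_) h
  · intro x hx
    exact (Real.contDiffAt_sqrt (hne x hx)).contMDiffAt.comp_contMDiffWithinAt x (h.inner h x hx)
  · exact (Real.sqrt_pos.mpr (lt_of_le_of_ne real_inner_self_nonneg (hne x hx).symm)).ne'

variable {D : ∀ x : M, Submodule ℝ (TangentSpace (𝓡 (n + l)) x)}

theorem IsSmoothDistribution.finrank_eq (hD : IsSmoothDistribution D) (x : M) :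
    finrank ℝ (D x) = n := by
  obtain ⟨U, hU, X, -, hX⟩ := hD x
  obtain ⟨h1, h2⟩ := hX x (mem_of_mem_nhds hU)
  rw [← h2, finrank_span_eq_card h1, Fintype.card_fin]

/-- A smooth distribution has an adapted frame near every point. -/
theorem IsSmoothDistribution.exists_isAdaptedFrame (hD : IsSmoothDistribution D) (x : M) :
    ∃ (U : Set M) (e : Fin (n + l) → ∀ x : M, TangentSpace (𝓡 (n + l)) x),
      x ∈ U ∧ IsAdaptedFrame D U e := by
  obtain ⟨U₁, hU₁, X, hXs, hX⟩ := hD x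
  have hrank : finrank ℝ ↥(D x)ᗮ = l := by
    have h1 := Submodule.finrank_add_finrank_orthogonal (D x)
    rw [hD.finrank_eq, (instFactFinrankTangentSpace x).out] at h1
    omega
  let w : Fin l → TangentSpace (𝓡 (n + l)) x := fun α =>
    ((stdOrthonormalBasis ℝ ↥(D x)ᗮ).reindex (finCongr hrank) α : TangentSpace (𝓡 (n + l)) x)
  choose V hV hVs using fun α => FiberBundle.exists_contMDiffOn_extend (k := ∞) (𝓡 (n + l))
    (EuclideanSpace ℝ (Fin (n + l))) (V := fun x : M => TangentSpace (𝓡 (n + l)) x) (w α)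
  -- The extended fields are known to be normal to `D` only at `x`. That gives independence at `x`,
  -- hence nearby by the Gram determinant; Gram-Schmidt then restores normality.
  let f : Fin (n + l) → ∀ y : M, TangentSpace (𝓡 (n + l)) y := fun A =>
    Fin.addCases (motive := fun _ => ∀ y : M, TangentSpace (𝓡 (n + l)) y) X
      (fun α => FiberBundle.extend (EuclideanSpace ℝ (Fin (n + l))) (w α)) A
  have hfX : ∀ i, f (Fin.castAdd l i) = X i := fun i => Fin.addCases_left i
  have hfw : ∀ α, f (Fin.natAdd n α) =
    FiberBundle.extend (EuclideanSpace ℝ (Fin (n + l))) (w α) := fun α => Fin.addCases_right α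
  have hfx : LinearIndependent ℝ fun A => f A x := by
    have hx := hX x (mem_of_mem_nhds hU₁)
    have hw : LinearIndependent ℝ w :=
      (((stdOrthonormalBasis ℝ ↥(D x)ᗮ).reindex (finCongr hrank)).orthonormal.comp_linearIsometry
        (D x)ᗮ.subtypeₗᵢ).linearIndependent
    have hdis : Disjoint (Submodule.span ℝ (Set.range fun i => X i x))
        (Submodule.span ℝ (Set.range w)) := by
      rw [hx.2]
      refine (Submodule.orthogonal_disjoint (D x)).mono_right (Submodule.span_le.mpr ?_)
      rintro _ ⟨α, rfl⟩
      exact Subtype.mem _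
    have h := (hx.1.sum_type hw hdis).comp _ finSumFinEquiv.symm.injective
    have hf : (fun A => f A x) = Sum.elim (fun i => X i x) w ∘ finSumFinEquiv.symm := by
      funext A
      refine Fin.addCases (fun i => ?_) (fun α => ?_) A
      · simp [hfX]
      · simp [hfw]
    rw [hf]
    exact h
  let W : Set M := interior U₁ ∩ ⋂ α, interior (V α)
  have hWo : IsOpen W := isOpen_interior.inter (isOpen_iInter_of_finite fun α => isOpen_interior)
  have hfs : ∀ A, IsSmoothFieldOn (f A) W := by
    intro A
    refine Fin.addCases (fun i => ?_) (fun α => ?_) A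
    · rw [hfX]
      exact (hXs i).mono (Set.inter_subset_left.trans interior_subset)
    · rw [hfw]
      exact (hVs α).mono (Set.inter_subset_right.trans
        ((Set.iInter_subset _ α).trans interior_subset))
  have hdet : ContinuousOn (fun y => (Matrix.gram ℝ fun A => f A y).det) W := by
    simp only [Matrix.det_apply]
    refine continuousOn_finsetSum _ fun σ _ => ContinuousOn.const_smul
      (continuousOn_finsetProd _ fun A _ => ?_) _
    exact ((hfs _).inner (hfs _)).continuousOn
  let U : Set M := W ∩ (fun y => (Matrix.gram ℝ fun A => f A y).det) ⁻¹' {0}ᶜ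
  have hUo : IsOpen U := hdet.isOpen_inter_preimage hWo isOpen_compl_singleton
  have hli : ∀ y ∈ U, LinearIndependent ℝ fun A => f A y := fun y hy =>
    Matrix.linearIndependent_of_det_gram_ne_zero hy.2
  have hUW : U ⊆ W := Set.inter_subset_left
  have hspan : ∀ y ∈ U, Submodule.span ℝ (Set.range fun i => X i y) = D y := fun y hy =>
    (hX y (interior_subset (hUW hy).1)).2
  refine ⟨U, fun A y => InnerProductSpace.gramSchmidtNormed ℝ (fun A => f A y) A, ?_, ?_⟩
  · refine ⟨⟨mem_interior_iff_mem_nhds.mpr hU₁,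
      Set.mem_iInter.mpr fun α => mem_interior_iff_mem_nhds.mpr (hV α)⟩, ?_⟩
    exact Matrix.det_gram_ne_zero_iff_linearIndependent.mpr hfx
  · refine ⟨hUo, fun A => isSmoothFieldOn_gramSchmidtNormed (fun A => (hfs A).mono hUW) hli A,
      fun y hy => InnerProductSpace.gramSchmidtNormed_orthonormal (hli y hy), ?_, ?_⟩
    · intro y hy i
      refine Submodule.smul_mem _ _ ?_
      have := InnerProductSpace.gramSchmidt_mem_span ℝ (fun A => f A y) (le_refl (Fin.castAdd l i))
      rw [← hspan y hy]
      refine Submodule.span_mono ?_ this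
      rintro _ ⟨A, hA, rfl⟩
      have hA' : (A : ℕ) < n := lt_of_le_of_lt (Fin.le_def.mp hA) i.2
      exact ⟨⟨A, hA'⟩, congrFun (hfX ⟨A, hA'⟩).symm y⟩
    · intro y hy α
      refine Submodule.smul_mem _ _ ?_
      rw [← hspan y hy, ← Submodule.span_singleton_le_iff_mem,
        Submodule.le_orthogonal_iff_le_orthogonal, Submodule.span_le]
      rintro _ ⟨i, rfl⟩
      rw [SetLike.mem_coe, Submodule.mem_orthogonal_singleton_iff_inner_right]
      -- The spanning fields of `D` come first in the list, so every later Gram-Schmidt vector is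
      -- orthogonal to them.
      have := InnerProductSpace.gramSchmidt_inv_triangular ℝ (fun A => f A y)
        (i := Fin.castAdd l i) (j := Fin.natAdd n α) (Fin.lt_def.mpr (by simp; omega))
      rw [hfX] at this
      exact this

theorem isPositiveBasis_of_det_pos {x : M}
    {o : Orientation ℝ (TangentSpace (𝓡 (n + l)) x) (Fin (n + l))}
    {v X : Fin (n + l) → TangentSpace (𝓡 (n + l)) x} (hv : Orthonormal ℝ v)
    (hX : IsPositiveBasis o X)
    (h : 0 < Matrix.det (Matrix.of fun A B => inner ℝ (v A) (X B))) : IsPositiveBasis o v := by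
  obtain ⟨b, rfl, rfl⟩ := hX
  refine ⟨(orthonormalBasisOfFrame hv).toBasis, by simp, ?_⟩
  rw [Basis.orientation_eq_iff_det_pos, Basis.det_apply]
  refine h.trans_eq (congrArg Matrix.det ?_)
  ext A B
  simp [Basis.toMatrix_apply, OrthonormalBasis.repr_apply_apply]

theorem det_inner_ne_zero {x : M} {v X : Fin (n + l) → TangentSpace (𝓡 (n + l)) x}
    (hv : Orthonormal ℝ v) (b : Basis (Fin (n + l)) ℝ (TangentSpace (𝓡 (n + l)) x)) (hb : ⇑b = X) :
    Matrix.det (Matrix.of fun A B => inner ℝ (v A) (X B)) ≠ 0 := by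
  have := ((orthonormalBasisOfFrame hv).toBasis.isUnit_det b).ne_zero
  rw [Basis.det_apply] at this
  convert this
  ext A B
  simp [Basis.toMatrix_apply, OrthonormalBasis.repr_apply_apply, hb]

/-- The determinant of an adapted frame against a positive smooth frame is continuous and nonzero at
`x`, so it keeps its sign nearby; if it is negative, the first vector is reversed. -/
theorem IsSmoothDistribution.exists_isAdaptedFrame_positive (hD : IsSmoothDistribution D)
    {o : ∀ x : M, Orientation ℝ (TangentSpace (𝓡 (n + l)) x) (Fin (n + l))}
    (ho : IsManifoldOrientation o) (x : M) :
    ∃ (U : Set M) (e : Fin (n + l) → ∀ x : M, TangentSpace (𝓡 (n + l)) x),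
      x ∈ U ∧ IsAdaptedFrame D U e ∧ ∀ y ∈ U, IsPositiveBasis (o y) (fun A => e A y) := by
  obtain ⟨U₁, e, hx₁, he⟩ := hD.exists_isAdaptedFrame x
  obtain ⟨U₂, hU₂, X, hXs, hX⟩ := ho x
  let g : M → ℝ := fun y => Matrix.det (Matrix.of fun A B => inner ℝ (e A y) (X B y))
  let W := U₁ ∩ interior U₂
  have hWo : IsOpen W := he.isOpen.inter isOpen_interior
  have hxW : x ∈ W := ⟨hx₁, mem_interior_iff_mem_nhds.mpr hU₂⟩
  have hg : ContinuousOn g W := by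
    simp only [g, Matrix.det_apply]
    refine continuousOn_finsetSum _ fun σ _ => ContinuousOn.const_smul
      (continuousOn_finsetProd _ fun A _ => ?_) _
    exact (IsSmoothFieldOn.inner (U := W) ((he.smooth _).mono Set.inter_subset_left)
      ((hXs _).mono (Set.inter_subset_right.trans interior_subset))).continuousOn
  have hgx : g x ≠ 0 := by
    obtain ⟨b, hb, -⟩ := hX x (mem_of_mem_nhds hU₂)
    exact det_inner_ne_zero (he.orthonormal x hx₁) b hb
  rcases lt_or_gt_of_ne hgx with hneg | hpos
  -- In dimension zero the empty determinant is `1`, so a vector to reverse always exists here.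
  · have hm : 0 < n + l := by
      by_contra h
      have : IsEmpty (Fin (n + l)) := ⟨fun A => h (lt_of_le_of_lt (Nat.zero_le _) A.2)⟩
      simp only [g, Matrix.det_isEmpty] at hneg
      linarith
    let ε : Fin (n + l) → ℝ := fun A => if A = ⟨0, hm⟩ then -1 else 1
    have hε : ∀ A, ε A * ε A = 1 := fun A => by simp only [ε]; split_ifs <;> norm_num
    let U := W ∩ g ⁻¹' Set.Iio 0
    have hU : U ⊆ U₁ := Set.inter_subset_left.trans Set.inter_subset_left
    have hort : ∀ y ∈ U, Orthonormal ℝ fun A => ε A • e A y := by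
      intro y hy
      have := orthonormal_iff_ite.mp (he.orthonormal y (hU hy))
      rw [orthonormal_iff_ite]
      intro A B
      rw [real_inner_smul_left, real_inner_smul_right, this]
      split_ifs with h
      · rw [h, mul_one, hε]
      · simp
    refine ⟨U, fun A y => ε A • e A y, ⟨hxW, hneg⟩, ⟨hg.isOpen_inter_preimage hWo isOpen_Iio, ?_,
      hort, ?_, ?_⟩, ?_⟩
    · exact fun A => IsSmoothFieldOn.smul contMDiffOn_const ((he.smooth A).mono hU)
    · exact fun y hy i => Submodule.smul_mem _ _ (he.tangent y (hU hy) i)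
    · exact fun y hy i => Submodule.smul_mem _ _ (he.normal y (hU hy) i)
    · intro y hy
      refine isPositiveBasis_of_det_pos (hort y hy) (hX y (interior_subset hy.1.2)) ?_
      simp only [real_inner_smul_left]
      have := Matrix.det_mul_column ε (Matrix.of fun A B => inner ℝ (e A y) (X B y))
      simp only [Matrix.of_apply] at this
      rw [this]
      have h1 : ∏ A, ε A = -1 := by simp [ε]
      rw [h1, neg_one_mul, neg_pos]
      exact hy.2
  · let U := W ∩ g ⁻¹' Set.Ioi 0
    have hU : U ⊆ U₁ := Set.inter_subset_left.trans Set.inter_subset_left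
    refine ⟨U, e, ⟨hxW, hpos⟩, ⟨hg.isOpen_inter_preimage hWo isOpen_Ioi,
      fun A => (he.smooth A).mono hU, fun y hy => he.orthonormal y (hU hy),
      fun y hy => he.tangent y (hU hy), fun y hy => he.normal y (hU hy)⟩, fun y hy => ?_⟩
    exact isPositiveBasis_of_det_pos (he.orthonormal y (hU hy)) (hX y (interior_subset hy.1.2)) hy.2

variable [T2Space M] {cov : CovariantDerivative (𝓡 (n + l)) (EuclideanSpace ℝ (Fin (n + l)))
      (fun x : M => TangentSpace (𝓡 (n + l)) x)}

/-- Smoothness of the connection is applied to a global field, obtained by cutting `X` off with a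
bump function equal to `1` near the point; locality identifies the derivatives there. -/
theorem isSmoothFieldOn_cov (hcov : IsLeviCivita cov) {U : Set M} (hU : IsOpen U)
    {X Y : ∀ x : M, TangentSpace (𝓡 (n + l)) x} (hX : IsSmoothFieldOn X U)
    (hY : IsSmoothFieldOn Y U) : IsSmoothFieldOn (fun x => cov X x (Y x)) U := by
  intro x hx
  obtain ⟨ψ, -, hψ⟩ := (SmoothBumpFunction.nhds_basis_tsupport (I := 𝓡 (n + l)) x).mem_iff.mp
    (hU.mem_nhds hx)
  have h1 : ContMDiff (𝓡 (n + l)) (𝓡 (n + l)).tangent ∞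
      (fun x => (⟨x, ((ψ : M → ℝ) • X) x⟩ : TangentBundle (𝓡 (n + l)) M)) :=
    ContMDiffOn.smul_section_of_tsupport ψ.contMDiff.contMDiffOn hU hψ hX
  have h2 := hcov.smooth.contMDiff.contMDiff (σ := (ψ : M → ℝ) • X) (h1.contMDiffOn)
  have h3 := ((h2.contMDiffAt Filter.univ_mem).clm_bundle_apply
    ((hY x hx).contMDiffAt (hU.mem_nhds hx)))
  refine (h3.congr_of_eventuallyEq ?_).contMDiffWithinAt
  filter_upwards [ψ.eventuallyEq_one.eventually_nhds, hU.mem_nhds hx] with y hy hyU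
  have : cov X y = cov ((ψ : M → ℝ) • X) y := by
    refine cov.isCovariantDerivativeOnUniv.congr_of_eventuallyEq (hX.mdifferentiableAt hU hyU)
      (h1.mdifferentiableAt (by simp)) Filter.univ_mem ?_
    filter_upwards [hy] with z hz
    simp [hz]
  simp only [this]

theorem continuous_meanCurvature (hD : IsSmoothDistribution D) (hcov : IsLeviCivita cov) (s : ℕ) :
    Continuous (meanCurvature cov D s) := by
  rw [continuous_iff_continuousAt]
  intro x
  obtain ⟨U, e, hx, he⟩ := hD.exists_isAdaptedFrame x
  suffices h : ContinuousOn (meanCurvature cov D s) U from h.continuousAt (he.isOpen.mem_nhds hx)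
  have h1 : ∀ y ∈ U, meanCurvature cov D s y = _ := fun y hy =>
    (meanCurvature_eq cov he s hy).trans (frameMeanCurvature_eq cov (he.orthonormal_normal hy)
      (he.starProjection_orthogonal hy) s e)
  refine ContinuousOn.congr ?_ h1
  refine continuousOn_const.mul (continuousOn_finsetSum _ fun β _ => continuousOn_finsetSum _
    fun i _ => continuousOn_finsetSum _ fun j _ => continuousOn_const.mul
      (continuousOn_finsetProd _ fun a _ => ?_))
  exact ((he.smooth _).inner (isSmoothFieldOn_cov hcov he.isOpen (he.smooth _)
    (he.smooth _))).continuousOn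

end Frames

/-! ### The Riemannian density and its transformation law -/

section Volume

variable {n l : ℕ} {M : Type*} [TopologicalSpace M]
  [ChartedSpace (EuclideanSpace ℝ (Fin (n + l))) M] [IsManifold (𝓡 (n + l)) ∞ M]
  [RiemannianBundle (fun x : M => TangentSpace (𝓡 (n + l)) x)]

/-- The Riemannian volume density `√det(⟨∂_A, ∂_B⟩)` in the chart `φ`. -/
def chartDensity (φ : OpenPartialHomeomorph M (EuclideanSpace ℝ (Fin (n + l))))
    (y : EuclideanSpace ℝ (Fin (n + l))) : ℝ :=
  Real.sqrt (Matrix.det (Matrix.of fun A B : Fin (n + l) =>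
      inner ℝ (coordinateField φ y A) (coordinateField φ y B)))

/-- In a positive orthonormal basis with coordinate matrix `P` of `v`, the form gives `det P` and
the Gram matrix is `Pᵀ P`, so its root determinant is `|det P|`. If `v` is degenerate both sides
vanish, so the default sign is harmless. -/
theorem orientationSign_mul_volumeForm {x : M}
    (o : Orientation ℝ (TangentSpace (𝓡 (n + l)) x) (Fin (n + l)))
    {e : Fin (n + l) → TangentSpace (𝓡 (n + l)) x} (he : Orthonormal ℝ e)
    (hpos : IsPositiveBasis o e) (v : Fin (n + l) → TangentSpace (𝓡 (n + l)) x) :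
    orientationSign o v * o.volumeForm v =
      Real.sqrt (Matrix.det (Matrix.of fun A B => inner ℝ (v A) (v B))) := by
  set b := orthonormalBasisOfFrame he with hb
  have hbo : b.toBasis.orientation = o := hpos.orientation_orthonormalBasisOfFrame he
  rw [o.volumeForm_robust b hbo]
  have hgram : Matrix.det (Matrix.of fun A B => (inner ℝ (v A) (v B) : ℝ)) =
      b.toBasis.det v * b.toBasis.det v := by
    rw [Basis.det_apply]
    conv_rhs => enter [1]; rw [← Matrix.det_transpose]
    rw [← Matrix.det_mul]
    congr 1
    ext A B
    rw [Matrix.mul_apply, Matrix.of_apply, ← b.sum_inner_mul_inner]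
    refine Finset.sum_congr rfl fun C _ => ?_
    simp [Basis.toMatrix_apply, OrthonormalBasis.repr_apply_apply, real_inner_comm]
  rw [hgram, Real.sqrt_mul_self_eq_abs, orientationSign]
  split_ifs with h
  · obtain ⟨b', rfl, hb'⟩ := h
    rw [one_mul, abs_of_pos]
    exact (Basis.orientation_eq_iff_det_pos _ _).mp (hbo.trans hb'.symm)
  · rw [neg_one_mul, abs_of_nonpos]
    by_contra hlt
    push Not at hlt
    apply h
    have hu := (Basis.is_basis_iff_det b.toBasis).mpr (isUnit_iff_ne_zero.mpr hlt.ne')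
    refine ⟨Basis.mk hu.1 hu.2.ge, Basis.coe_mk _ _, ?_⟩
    rw [← hbo, eq_comm, Basis.orientation_eq_iff_det_pos, Basis.coe_mk]
    exact hlt

/-- The inner products live on the tangent spaces at `f y` and `g y`, distinct as types. Viewing the
metric as a function on the fixed model space lets the base point be substituted. -/
theorem inner_mfderiv_congr {f g : EuclideanSpace ℝ (Fin (n + l)) → M}
    {y : EuclideanSpace ℝ (Fin (n + l))} (h : f =ᶠ[𝓝 y] g) (u v : EuclideanSpace ℝ (Fin (n + l))) :
    inner ℝ (mfderiv (𝓡 (n + l)) (𝓡 (n + l)) f y u) (mfderiv (𝓡 (n + l)) (𝓡 (n + l)) f y v) =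
      inner ℝ (mfderiv (𝓡 (n + l)) (𝓡 (n + l)) g y u)
        (mfderiv (𝓡 (n + l)) (𝓡 (n + l)) g y v) := by
  let F : M → EuclideanSpace ℝ (Fin (n + l)) → EuclideanSpace ℝ (Fin (n + l)) → ℝ :=
    fun x => fun u v : TangentSpace (𝓡 (n + l)) x => inner ℝ u v
  have h1 := h.mfderiv_eq (I := 𝓡 (n + l)) (I' := 𝓡 (n + l))
  have h2 : ∀ w : EuclideanSpace ℝ (Fin (n + l)),
      (mfderiv (𝓡 (n + l)) (𝓡 (n + l)) f y w : EuclideanSpace ℝ (Fin (n + l))) =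
        mfderiv (𝓡 (n + l)) (𝓡 (n + l)) g y w := fun w => congrArg
    (fun L : EuclideanSpace ℝ (Fin (n + l)) →L[ℝ] EuclideanSpace ℝ (Fin (n + l)) => L w) h1
  have h3 : ∀ x x', x = x' → ∀ u u', u = u' → ∀ v v', v = v' → F x u v = F x' u' v' := by
    rintro _ _ rfl _ _ rfl _ _ rfl
    rfl
  exact h3 _ _ h.eq_of_nhds _ _ (h2 u) _ _ (h2 v)

theorem det_inner_comp {V : Type*} [NormedAddCommGroup V] [InnerProductSpace ℝ V] {m : ℕ}
    (L : EuclideanSpace ℝ (Fin m) →ₗ[ℝ] V)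
    (T : EuclideanSpace ℝ (Fin m) →ₗ[ℝ] EuclideanSpace ℝ (Fin m)) :
    Matrix.det (Matrix.of fun A B => (inner ℝ (L (T (EuclideanSpace.single A 1)))
      (L (T (EuclideanSpace.single B 1))) : ℝ)) =
    LinearMap.det T * LinearMap.det T * Matrix.det (Matrix.of fun A B =>
      (inner ℝ (L (EuclideanSpace.single A 1)) (L (EuclideanSpace.single B 1)) : ℝ)) := by
  let b := (EuclideanSpace.basisFun (Fin m) ℝ).toBasis
  have hdet : LinearMap.det T = Matrix.det (LinearMap.toMatrix b b T) :=
    (LinearMap.det_toMatrix b T).symm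
  set J := LinearMap.toMatrix b b T with hJ
  have hT : ∀ A, T (EuclideanSpace.single A 1) = ∑ C, J C A • EuclideanSpace.single C (1 : ℝ) := by
    intro A
    have := b.sum_repr (T (b A))
    rw [← b.sum_repr (T (EuclideanSpace.single A 1))]
    refine Finset.sum_congr rfl fun C _ => ?_
    simp [hJ, b, LinearMap.toMatrix_apply]
  have : (Matrix.of fun A B => (inner ℝ (L (T (EuclideanSpace.single A 1)))
      (L (T (EuclideanSpace.single B 1))) : ℝ)) = J.transpose * (Matrix.of fun A B =>
      (inner ℝ (L (EuclideanSpace.single A 1)) (L (EuclideanSpace.single B 1)) : ℝ)) * J := by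
    ext A B
    rw [Matrix.of_apply, hT, hT, map_sum, map_sum, inner_sum, Matrix.mul_apply]
    refine Finset.sum_congr rfl fun C _ => ?_
    rw [map_smul, inner_smul_right, sum_inner, Matrix.mul_apply, mul_comm, Finset.sum_mul,
      Finset.sum_mul]
    refine Finset.sum_congr rfl fun E _ => ?_
    rw [map_smul, real_inner_smul_left]
    simp
  rw [this, Matrix.det_mul, Matrix.det_mul, Matrix.det_transpose, hdet]
  ring

variable {φ ψ : OpenPartialHomeomorph M (EuclideanSpace ℝ (Fin (n + l)))}

theorem isOpen_transition_domain :
    IsOpen (ψ.target ∩ ψ.symm ⁻¹' φ.source) :=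
  ψ.isOpen_inter_preimage_symm φ.open_source

theorem differentiableAt_transition (hφ : φ ∈ IsManifold.maximalAtlas (𝓡 (n + l)) ∞ M)
    (hψ : ψ ∈ IsManifold.maximalAtlas (𝓡 (n + l)) ∞ M)
    {y : EuclideanSpace ℝ (Fin (n + l))} (hy : y ∈ ψ.target ∩ ψ.symm ⁻¹' φ.source) :
    DifferentiableAt ℝ (fun y => φ (ψ.symm y)) y := by
  have h1 := contMDiffAt_symm_of_mem_maximalAtlas hψ hy.1
  have h2 := contMDiffAt_of_mem_maximalAtlas hφ hy.2
  exact (h2.comp y h1).contDiffAt.differentiableAt (by simp)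

/-- Chain rule for `ψ⁻¹ = φ⁻¹ ∘ (φ ∘ ψ⁻¹)`: the Gram matrix becomes `Jᵀ G J`, with root determinant
`|det J| √det G`. -/
theorem chartDensity_transition (hφ : φ ∈ IsManifold.maximalAtlas (𝓡 (n + l)) ∞ M)
    (hψ : ψ ∈ IsManifold.maximalAtlas (𝓡 (n + l)) ∞ M)
    {y : EuclideanSpace ℝ (Fin (n + l))} (hy : y ∈ ψ.target ∩ ψ.symm ⁻¹' φ.source) :
    chartDensity ψ y = |(fderiv ℝ (fun y => φ (ψ.symm y)) y).det| *
      chartDensity φ (φ (ψ.symm y)) := by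
  have hev : ψ.symm =ᶠ[𝓝 y] φ.symm ∘ fun y => φ (ψ.symm y) := by
    filter_upwards [isOpen_transition_domain.mem_nhds hy] with z hz
    exact (φ.left_inv hz.2).symm
  have hd := differentiableAt_transition hφ hψ hy
  have hcomp : mfderiv (𝓡 (n + l)) (𝓡 (n + l)) (φ.symm ∘ fun y => φ (ψ.symm y)) y =
      (mfderiv (𝓡 (n + l)) (𝓡 (n + l)) φ.symm (φ (ψ.symm y))).comp
        (mfderiv (𝓡 (n + l)) (𝓡 (n + l)) (fun y => φ (ψ.symm y)) y) :=
    mfderiv_comp y ((contMDiffAt_symm_of_mem_maximalAtlas hφ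
      (φ.map_source hy.2)).mdifferentiableAt (by simp)) hd.mdifferentiableAt
  rw [mfderiv_eq_fderiv] at hcomp
  unfold chartDensity coordinateField
  simp only [inner_mfderiv_congr hev]
  rw [hcomp]
  have := det_inner_comp
    (mfderiv (𝓡 (n + l)) (𝓡 (n + l)) φ.symm (φ (ψ.symm y))).toLinearMap
    (fderiv ℝ (fun y => φ (ψ.symm y)) y).toLinearMap
  refine (congrArg Real.sqrt this).trans ?_
  rw [Real.sqrt_mul (mul_self_nonneg _), Real.sqrt_mul_self_eq_abs]
  rfl

variable [IsContMDiffRiemannianBundle (𝓡 (n + l)) ∞ (EuclideanSpace ℝ (Fin (n + l)))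
      (fun x : M => TangentSpace (𝓡 (n + l)) x)]

/-- The coordinate fields are images of constant fields under the smooth tangent map of `φ.symm`. -/
theorem continuousOn_chartDensity (hφ : φ ∈ IsManifold.maximalAtlas (𝓡 (n + l)) ∞ M) :
    ContinuousOn (chartDensity φ) φ.target := by
  have h1 := (contMDiffOn_symm_of_mem_maximalAtlas hφ).contMDiffOn_tangentMapWithin (m := ∞)
    (by simp) φ.open_target.uniqueMDiffOn
  have h2 : ∀ A : Fin (n + l), ContMDiffOn (𝓡 (n + l)) (𝓡 (n + l)).tangent ∞ (fun y =>
      (⟨φ.symm y, coordinateField φ y A⟩ : TangentBundle (𝓡 (n + l)) M)) φ.target := by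
    intro A
    have h3 : ContMDiff (𝓡 (n + l)) (𝓡 (n + l)).tangent ∞ (fun y : EuclideanSpace ℝ (Fin (n + l)) =>
        (⟨y, EuclideanSpace.single A (1 : ℝ)⟩ :
          TangentBundle (𝓡 (n + l)) (EuclideanSpace ℝ (Fin (n + l))))) :=
      contMDiff_vectorSpace_iff_contDiff.mpr contDiff_const
    refine (h1.comp h3.contMDiffOn (fun y hy => hy)).congr fun y hy => ?_
    simp only [Function.comp_apply, tangentMapWithin, coordinateField]
    rw [mfderivWithin_of_isOpen φ.open_target hy]
  unfold chartDensity
  refine Real.continuous_sqrt.comp_continuousOn ?_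
  simp only [Matrix.det_apply]
  refine continuousOn_finsetSum _ fun σ _ => ContinuousOn.const_smul
      (continuousOn_finsetProd _ fun A _ => ?_) _
  exact (ContMDiffOn.inner_bundle (b := φ.symm) (h2 _) (h2 _)).continuousOn

end Volume

/-! ### The Riemannian volume measure -/

section Measure

variable {n l : ℕ} {M : Type*} [TopologicalSpace M]
  [ChartedSpace (EuclideanSpace ℝ (Fin (n + l))) M] [IsManifold (𝓡 (n + l)) ∞ M]
  [RiemannianBundle (fun x : M => TangentSpace (𝓡 (n + l)) x)]
  [MeasurableSpace M] [BorelSpace M]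
  {φ ψ : OpenPartialHomeomorph M (EuclideanSpace ℝ (Fin (n + l)))}

theorem measurableSet_target_inter_preimage {B : Set M} (hB : MeasurableSet B) :
    MeasurableSet (φ.target ∩ φ.symm ⁻¹' B) := by
  have h1 : Measurable (φ.target.domRestrict φ.symm) :=
    (continuousOn_iff_continuous_domRestrict.mp φ.continuousOn_symm).measurable
  have h2 := φ.open_target.measurableSet.subtype_image (h1 hB)
  convert h2 using 1
  ext y
  constructor
  · rintro ⟨hy, hyB⟩
    exact ⟨⟨y, hy⟩, hyB, rfl⟩
  · rintro ⟨⟨y, hy⟩, hyB, rfl⟩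
    exact ⟨hy, hyB⟩

/-- `φ.symm` is controlled only on the target, so the pushforward is handled through
almost-everywhere measurability. -/
theorem aemeasurable_chart_symm (d : EuclideanSpace ℝ (Fin (n + l)) → ENNReal) :
    AEMeasurable φ.symm ((volume.restrict φ.target).withDensity d) :=
  (φ.continuousOn_symm.aemeasurable φ.open_target.measurableSet).mono_ac
    (withDensity_absolutelyContinuous _ _)

theorem chartVolume_apply {B : Set M} (hB : MeasurableSet B) :
    chartVolume φ B = ∫⁻ y in φ.target ∩ φ.symm ⁻¹' B, ENNReal.ofReal (chartDensity φ y) := by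
  unfold chartVolume
  rw [Measure.map_apply_of_aemeasurable (aemeasurable_chart_symm _) hB, withDensity_apply',
    Measure.restrict_restrict' φ.open_target.measurableSet, Set.inter_comm]
  rfl

theorem chartVolume_inter_source {B : Set M} (hB : MeasurableSet B) :
    chartVolume φ (B ∩ φ.source) = chartVolume φ B := by
  rw [chartVolume_apply hB, chartVolume_apply (hB.inter φ.open_source.measurableSet)]
  congr 2
  ext y
  simp only [Set.mem_inter_iff, Set.mem_preimage]
  exact ⟨fun h => ⟨h.1, h.2.1⟩, fun h => ⟨h.1, h.2, φ.map_target h.1⟩⟩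

/-- The Riemannian volumes of two charts agree on the overlap. -/
theorem chartVolume_eq_of_subset (hφ : φ ∈ IsManifold.maximalAtlas (𝓡 (n + l)) ∞ M)
    (hψ : ψ ∈ IsManifold.maximalAtlas (𝓡 (n + l)) ∞ M) {B : Set M} (hB : MeasurableSet B)
    (hBφ : B ⊆ φ.source) (hBψ : B ⊆ ψ.source) : chartVolume ψ B = chartVolume φ B := by
  rw [chartVolume_apply hB, chartVolume_apply hB]
  set S := ψ.target ∩ ψ.symm ⁻¹' B with hS
  have hSm : MeasurableSet S := measurableSet_target_inter_preimage hB
  have hSd : ∀ y ∈ S, y ∈ ψ.target ∩ ψ.symm ⁻¹' φ.source := fun y hy => ⟨hy.1, hBφ hy.2⟩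
  have himage : φ.target ∩ φ.symm ⁻¹' B = (fun y => φ (ψ.symm y)) '' S := by
    ext z
    constructor
    · rintro ⟨hz, hzB⟩
      refine ⟨ψ (φ.symm z), ⟨ψ.map_source (hBψ hzB), ?_⟩, ?_⟩
      · rw [Set.mem_preimage, ψ.left_inv (hBψ hzB)]
        exact hzB
      · simp only
        rw [ψ.left_inv (hBψ hzB), φ.right_inv hz]
    · rintro ⟨y, hy, rfl⟩
      refine ⟨φ.map_source (hBφ hy.2), ?_⟩
      rw [Set.mem_preimage, φ.left_inv (hBφ hy.2)]
      exact hy.2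
  have hinj : Set.InjOn (fun y => φ (ψ.symm y)) S := by
    intro y hy z hz h
    exact ψ.symm.injOn hy.1 hz.1 (φ.injOn (hBφ hy.2) (hBφ hz.2) h)
  rw [himage, lintegral_image_eq_lintegral_abs_det_fderiv_mul volume hSm
    (fun y hy => (differentiableAt_transition hφ hψ
      (hSd y hy)).hasFDerivAt.hasFDerivWithinAt) hinj]
  refine setLIntegral_congr_fun hSm fun y hy => ?_
  rw [chartDensity_transition hφ hψ (hSd y hy), ENNReal.ofReal_mul (abs_nonneg _)]

theorem chartVolume_le_riemannianVolume (hφ : φ ∈ IsManifold.maximalAtlas (𝓡 (n + l)) ∞ M) :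
    chartVolume φ ≤ riemannianVolume n l M :=
  le_iSup₂_of_le φ hφ le_rfl

/-- On the domain of a chart, the Riemannian volume is the Riemannian volume of the chart. -/
theorem riemannianVolume_restrict_source
    (hφ : φ ∈ IsManifold.maximalAtlas (𝓡 (n + l)) ∞ M) :
    (riemannianVolume n l M).restrict φ.source = chartVolume φ := by
  have hs := φ.open_source.measurableSet
  -- The right side bounds every chart volume, hence their supremum: inside `φ.source` the measure
  -- of `ψ` lives on the overlap, where it agrees with that of `φ`; outside, the supremum itself
  -- dominates.
  have hle : riemannianVolume n l M ≤
      chartVolume φ + (riemannianVolume n l M).restrict φ.sourceᶜ := by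
    refine iSup₂_le fun ψ hψ => Measure.le_iff.mpr fun A hA => ?_
    rw [← measure_inter_add_sdiff A hs, Measure.add_apply, Measure.restrict_apply hA]
    refine add_le_add ?_ (chartVolume_le_riemannianVolume hψ _)
    have hm := (hA.inter hs).inter ψ.open_source.measurableSet
    rw [← chartVolume_inter_source (hA.inter hs),
      chartVolume_eq_of_subset hφ hψ hm (fun x hx => hx.1.2) (fun x hx => hx.2)]
    exact measure_mono fun x hx => hx.1.1
  ext A hA
  rw [Measure.restrict_apply hA]
  refine le_antisymm ?_ ?_
  · refine (hle _).trans ?_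
    rw [Measure.add_apply, Measure.restrict_apply (hA.inter hs), chartVolume_inter_source hA]
    simp [Set.inter_assoc]
  · rw [← chartVolume_inter_source hA]
    exact chartVolume_le_riemannianVolume hφ _

variable [IsContMDiffRiemannianBundle (𝓡 (n + l)) ∞ (EuclideanSpace ℝ (Fin (n + l)))
      (fun x : M => TangentSpace (𝓡 (n + l)) x)]

/-- The density is continuous, hence integrable over a compact neighbourhood in the chart. This
makes continuous functions integrable when `M` is compact. -/
theorem isLocallyFiniteMeasure_riemannianVolume [T2Space M] :
    IsLocallyFiniteMeasure (riemannianVolume n l M) := by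
  refine ⟨fun x => ?_⟩
  set φ := chartAt (EuclideanSpace ℝ (Fin (n + l))) x
  have hφ : φ ∈ IsManifold.maximalAtlas (𝓡 (n + l)) ∞ M := IsManifold.chart_mem_maximalAtlas x
  have hx : x ∈ φ.source := mem_chart_source _ x
  obtain ⟨K, hK, hKt, hKc⟩ := local_compact_nhds (φ.open_target.mem_nhds (φ.map_source hx))
  have hopen : IsOpen (φ.source ∩ φ ⁻¹' interior K) :=
    φ.isOpen_inter_preimage isOpen_interior
  refine ⟨φ.source ∩ φ ⁻¹' interior K, hopen.mem_nhds ⟨hx, mem_interior_iff_mem_nhds.mpr hK⟩, ?_⟩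
  have h1 : riemannianVolume n l M (φ.source ∩ φ ⁻¹' interior K) =
      chartVolume φ (φ.source ∩ φ ⁻¹' interior K) := by
    rw [← riemannianVolume_restrict_source hφ, Measure.restrict_apply hopen.measurableSet,
      Set.inter_eq_left.mpr Set.inter_subset_left]
  rw [h1, chartVolume_apply hopen.measurableSet]
  have h2 : IntegrableOn (chartDensity φ) K volume :=
    ((continuousOn_chartDensity hφ).mono hKt).integrableOn_compact hKc
  refine lt_of_le_of_lt (lintegral_mono_set ?_) h2.lintegral_lt_top
  rintro y ⟨hy, hy'⟩
  have := hy'.2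
  rw [Set.mem_preimage, φ.right_inv hy] at this
  exact interior_subset this

theorem integral_riemannianVolume_of_support_subset
    (hφ : φ ∈ IsManifold.maximalAtlas (𝓡 (n + l)) ∞ M) {h : M → ℝ} (hc : Continuous h)
    (hsupp : ∀ x, x ∉ φ.source → h x = 0) :
    ∫ x, h x ∂(riemannianVolume n l M) =
      ∫ y in φ.target, chartDensity φ y * h (φ.symm y) := by
  rw [← setIntegral_eq_integral_of_forall_compl_eq_zero hsupp,
    riemannianVolume_restrict_source hφ, chartVolume,
    integral_map (aemeasurable_chart_symm _) hc.aestronglyMeasurable,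
    integral_withDensity_eq_integral_toReal_smul₀]
  · refine integral_congr_ae (Filter.Eventually.of_forall fun y => ?_)
    simp only [smul_eq_mul]
    congr 1
    exact ENNReal.toReal_ofReal (Real.sqrt_nonneg _)
  · exact ((continuousOn_chartDensity hφ).aemeasurable φ.open_target.measurableSet).ennreal_ofReal
  · exact Filter.Eventually.of_forall fun y => ENNReal.ofReal_lt_top

end Measure

/-! ### Integration over a compact manifold -/

section TotalCurvature

variable {n l : ℕ} {M : Type*} [TopologicalSpace M]
  [ChartedSpace (EuclideanSpace ℝ (Fin (n + l))) M] [IsManifold (𝓡 (n + l)) ∞ M]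
  [RiemannianBundle (fun x : M => TangentSpace (𝓡 (n + l)) x)]
  [IsContMDiffRiemannianBundle (𝓡 (n + l)) ∞ (EuclideanSpace ℝ (Fin (n + l)))
      (fun x : M => TangentSpace (𝓡 (n + l)) x)]
  {o : ∀ x : M, Orientation ℝ (TangentSpace (𝓡 (n + l)) x) (Fin (n + l))}
  {D : ∀ x : M, Submodule ℝ (TangentSpace (𝓡 (n + l)) x)}
  {cov : CovariantDerivative (𝓡 (n + l)) (EuclideanSpace ℝ (Fin (n + l)))
      (fun x : M => TangentSpace (𝓡 (n + l)) x)}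

theorem smul_gammaWedgeNu (hD : IsSmoothDistribution D) (ho : IsManifoldOrientation o) {s : ℕ}
    (hs : 2 * s ≤ n) (x : M) :
    (1 / (((2 * s).factorial : ℝ) * ((n - 2 * s).factorial : ℝ))) • gammaWedgeNu cov D o s x =
      meanCurvature cov D s x • (o x).volumeForm := by
  have h : ∃ e : Fin (n + l) → ∀ x : M, TangentSpace (𝓡 (n + l)) x,
      ∃ U : Set M, x ∈ U ∧ IsAdaptedFrame D U e ∧
        ∀ y ∈ U, IsPositiveBasis (o y) (fun A => e A y) := by
    obtain ⟨U, e, he⟩ := hD.exists_isAdaptedFrame_positive ho x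
    exact ⟨e, U, he⟩
  rw [gammaWedgeNu, dif_pos h]
  obtain ⟨U, hx, he, hpos⟩ := h.choose_spec
  exact smul_wedge_gammaForm cov o he hs hx (hpos x hx)

/-- The total curvature is the integral of the mean curvature `S_r`. -/
theorem totalCurvature_eq_integral [T2Space M] [CompactSpace M] [MeasurableSpace M] [BorelSpace M]
    (hD : IsSmoothDistribution D) (ho : IsManifoldOrientation o) (hcov : IsLeviCivita cov) {s : ℕ}
    (hs : 2 * s ≤ n) (P : ChartPartition n l M) :
    totalCurvature P cov D o s =
      ∫ x, meanCurvature cov D s x ∂(riemannianVolume n l M) := by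
  have := isLocallyFiniteMeasure_riemannianVolume (n := n) (l := l) (M := M)
  have hS := continuous_meanCurvature hD hcov s
  have hρS : ∀ i, Continuous fun x => P.weight i x * meanCurvature cov D s x := fun i =>
    (P.weight i).contMDiff.continuous.mul hS
  have hsum : ∀ x, meanCurvature cov D s x =
      ∑ i, P.weight i x * meanCurvature cov D s x := by
    intro x
    have h1 := P.weight.sum_eq_one (Set.mem_univ x)
    rw [finsum_eq_sum_of_fintype] at h1
    rw [← Finset.sum_mul, h1, one_mul]
  rw [integral_congr_ae (Filter.Eventually.of_forall hsum), integral_finsetSum _ fun i _ =>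
    (hρS i).integrable_of_hasCompactSupport (HasCompactSupport.of_compactSpace _)]
  unfold totalCurvature formIntegral
  rw [Finset.mul_sum]
  refine Finset.sum_congr rfl fun i _ => ?_
  rw [integral_riemannianVolume_of_support_subset (P.chart_mem i) (hρS i), ← integral_const_mul]
  · refine integral_congr_ae (Filter.Eventually.of_forall fun y => ?_)
    -- The integrands agree pointwise: the frame identity is evaluated on the coordinate fields, and
    -- the frame found here converts the signed volume form into the density.
    obtain ⟨U, e, hx, he, hpos⟩ := hD.exists_isAdaptedFrame_positive ho ((P.chart i).symm y)
    have h1 := congrArg (fun Ψ => Ψ (coordinateField (P.chart i) y))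
      (smul_gammaWedgeNu (cov := cov) hD ho hs ((P.chart i).symm y))
    have h2 := orientationSign_mul_volumeForm (o ((P.chart i).symm y)) (he.orthonormal _ hx)
      (hpos _ hx) (coordinateField (P.chart i) y)
    simp only [AlternatingMap.smul_apply, smul_eq_mul] at h1
    simp only [chartDensity]
    rw [← h2]
    linear_combination (P.weight i ((P.chart i).symm y) *
      orientationSign (o ((P.chart i).symm y)) (coordinateField (P.chart i) y)) * h1
  · intro x hx
    have : P.weight i x = 0 := image_eq_zero_of_notMem_tsupport fun h => hx (P.subordinate i h)
    rw [this, zero_mul]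

end TotalCurvature

end DistributionCurvature

end

theorem theorem1 {n l : ℕ} {M : Type*} [TopologicalSpace M] [T2Space M]
    [SecondCountableTopology M] [ChartedSpace (EuclideanSpace ℝ (Fin (n + l))) M]
    [IsManifold (𝓡 (n + l)) ∞ M]
    [RiemannianBundle (fun x : M => TangentSpace (𝓡 (n + l)) x)]
    [IsContMDiffRiemannianBundle (𝓡 (n + l)) ∞ (EuclideanSpace ℝ (Fin (n + l)))
      (fun x : M => TangentSpace (𝓡 (n + l)) x)]
    [MeasurableSpace M] [BorelSpace M]
    (o : ∀ x : M, Orientation ℝ (TangentSpace (𝓡 (n + l)) x) (Fin (n + l)))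
    (ho : DistributionCurvature.IsManifoldOrientation o)
    (D : ∀ x : M, Submodule ℝ (TangentSpace (𝓡 (n + l)) x))
    (hD : DistributionCurvature.IsSmoothDistribution D)
    (cov : CovariantDerivative (𝓡 (n + l)) (EuclideanSpace ℝ (Fin (n + l)))
      (fun x : M => TangentSpace (𝓡 (n + l)) x))
    (hcov : DistributionCurvature.IsLeviCivita cov)
    (s : ℕ) (hs : 2 * s ≤ n) :
    (∀ (U : Set M) (e : Fin (n + l) → ∀ x : M, TangentSpace (𝓡 (n + l)) x),
      DistributionCurvature.IsAdaptedFrame D U e →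
        (∀ x ∈ U, DistributionCurvature.meanCurvature cov D s x =
          DistributionCurvature.frameMeanCurvature cov D s e x) ∧
        ((∀ x ∈ U, DistributionCurvature.IsPositiveBasis (o x) (fun A => e A x)) →
          ∀ x ∈ U,
            (1 / (((2 * s).factorial : ℝ) * ((n - 2 * s).factorial : ℝ))) •
              DistributionCurvature.wedge (DistributionCurvature.gammaForm cov s e x)
                (DistributionCurvature.transverseForm e x) =
            DistributionCurvature.meanCurvature cov D s x • (o x).volumeForm)) ∧
    (CompactSpace M → ∀ P : DistributionCurvature.ChartPartition n l M,
      DistributionCurvature.totalCurvature P cov D o s =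
        ∫ x, DistributionCurvature.meanCurvature cov D s x
          ∂(DistributionCurvature.riemannianVolume n l M)) := by
  refine ⟨fun U e he => ⟨fun x hx => DistributionCurvature.meanCurvature_eq cov he s hx,
    fun hpos x hx => DistributionCurvature.smul_wedge_gammaForm cov o he hs hx (hpos x hx)⟩,
    fun _ P => DistributionCurvature.totalCurvature_eq_integral hD ho hcov hs P⟩
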